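/- Let $\alpha,\beta>-1$ be real and $N\ge 1$ an integer. Let $W_{d,\ge}^{n}$ be the set of $\lambda=(\lambda_1\le\cdots\le\lambda_n)$ with $\lambda_i\in\{0,1,2,\dots\}$. Write $\Delta_n(x)=\prod_{1\le i<j\le n}(x_j-x_i)$, $(x)_n=x(x+1)\cdots(x+n-1)$, and $\lambda^2=(\lambda_1^2,\dots,\lambda_n^2)$. Let $\mathfrak p_n(x)=\frac{\Gamma(n+\alpha+1)}{\Gamma(n+1)\Gamma(\alpha+1)}\,{}_2F_1\!\left(-n,n+\alpha+\beta+1;\alpha+1;\frac{1-x}{2}\right)$ be the Jacobi polynomials. For $\lambda\in W_{d,\ge}^n$ let $\mathfrak P_\lambda$ be the multivariate Jacobi polynomial, i.e. the polynomial $$\mathfrak P_\lambda(x_1,\dots,x_n)=\frac{\det_{i,j=1}^n[\mathfrak p_{\lambda_i+i-1}(x_j)]}{\Delta_n(x)},$$ and $\mathfrak P_\lambda(1_n)$ its value at $(1,\dots,1)$. Put $c_{\lambda,n}=\Gamma(\alpha+1)^n\prod_{i=1}^n\frac{\Gamma(\lambda_i+i)}{\Gamma(\lambda_i+i+\alpha)}$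 and, for $\mu,\nu\in W^N_{d,\ge}$, $A_{\mu,\nu}=\prod_{i=1}^{N}B(\mu_i+i-1,\nu_i+i-1)$, where $$B(m,l)=\frac{(2m+\alpha+\beta+2)\,\Gamma(m+\beta+1)\,m!\,(2l+\alpha+\beta+1)\Gamma(l+\alpha+\beta+1)\,\Gamma(l+\alpha+1)}{2\,\Gamma(m+\alpha+\beta+2)\,\Gamma(m+\alpha+2)\,\Gamma(l+\beta+1)\,l!},$$ with $(2l+\alpha+\beta+1)\Gamma(l+\alpha+\beta+1)$ read as $\Gamma(\alpha+\beta+2)$ when $l=0$. For $\lambda\in W_{d,\ge}^{N+1}$ and $\nu\in W_{d,\ge}^N$ define $$L^{N+1}_{N,\alpha,\beta}(\lambda,\nu)=\sum_{\mu}\frac{c_{\nu,N}}{c_{\lambda,N+1}}A_{\mu,\nu}\frac{\mathfrak P_\nu(1_N)}{\mathfrak P_\lambda(1_{N+1})},$$ the sum being over integer $\mu$ with $\lambda_1\le\mu_1\le\lambda_2\le\cdots\le\mu_N\le\lambda_{N+1}$ and $0\le\nu_1\le\mu_1\le\nu_2\le\cdots\le\nu_N\le\mu_N$. Then: 1. $L^{N+1}_{N,\alpha,\beta}$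 is Markov: for every $\lambda\in W_{d,\ge}^{N+1}$, $L^{N+1}_{N,\alpha,\beta}(\lambda,\nu)\ge0$ for all $\nu\in W_{d,\ge}^N$, and $\sum_{\nu\in W_{d,\ge}^N}L^{N+1}_{N,\alpha,\beta}(\lambda,\nu)=1$. 2. Let $\lambda\in W_{d,\ge}^{N+1}$ with $0\le\lambda_1<\cdots<\lambda_{N+1}$, and for $\kappa\in\{0,1,2,\dots\}$ let $Z_{\kappa\lambda}$ be a random variable with law $L^{N+1}_{N,\alpha,\beta}(\kappa\lambda,\cdot)$. As $\kappa\to\infty$, the distribution of $\kappa^{-1}Z_{\kappa\lambda}$ converges weakly to the probability measure $$M_\lambda(d\nu)=2^{2N}N!\,(\alpha+1)_N\frac{\Delta_N(\nu^2)}{\Delta_{N+1}(\lambda^2)}\left(\int_{\{\mu\in\mathbb R^N:\ \lambda_1\le\mu_1\le\lambda_2\le\cdots\le\mu_N\le\lambda_{N+1}\}}\mathbf 1_{\{0\le\nu_1\le\mu_1\le\nu_2\le\cdots\le\nu_N\le\mu_N\}}\prod_{k=1}^N\frac{\nu_k^{2\alpha+1}}{\mu_k^{2\alpha+1}}\,d\mu\right)d\nu$$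 on $\mathbb R^N$; in particular $M_\lambda$ has total mass $1$. 3. For all real $0\le\lambda_1<\cdots<\lambda_{N+1}$, the image of the measure $M_\lambda$ (given by the same formula) under $\nu\mapsto(\nu_1^2,\dots,\nu_N^2)$ is $\Lambda^{N+1}_{\alpha,N}(\lambda^2,\cdot)$, where $\Lambda^{N+1}_{\alpha,N}(x,\cdot)$ is the measure on $\{y\in\mathbb R^N:0\le y_1\le\cdots\le y_N\}$ given by $$\Lambda^{N+1}_{\alpha,N}(x,dy)=N!\,(\alpha+1)_N\frac{\Delta_N(y)}{\Delta_{N+1}(x)}\prod_{k=1}^N\left(\mathbf 1_{[x_{k-1},x_{k+1}]}(y_k)\int_{x_k\vee y_k}^{x_{k+1}\wedge y_{k+1}}\frac{y_k^\alpha}{z^{\alpha+1}}\,dz\right)dy,\qquad x_0=0,\ y_{N+1}=\infty.$$ -/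

import Mathlib

open MeasureTheory ProbabilityTheory Filter Topology
open scoped BoundedContinuousFunction

namespace JacobiBranching

noncomputable section

/-- Weakly increasing `N`-tuples of natural numbers, i.e. partitions with at most `N` parts,
written in increasing order. -/
abbrev DiscreteChamber (N : ℕ) : Type := {lam : Fin N → ℕ // Monotone lam}

/-- The dilated tuple `κ λ`. -/
def DiscreteChamber.scale {N : ℕ} (κ : ℕ) (lam : DiscreteChamber N) : DiscreteChamber N :=
  ⟨fun i => κ * lam.1 i, fun _ _ h => Nat.mul_le_mul_left κ (lam.2 h)⟩

/-- `Δ_n(x) = ∏_{i<j} (x_j - x_i)`. -/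
def vdm {R : Type*} [CommRing R] {n : ℕ} (x : Fin n → R) : R :=
  ∏ i : Fin n, ∏ j ∈ Finset.Ioi i, (x j - x i)

/-- The shifted factorial `(x)_n = x (x+1) ⋯ (x+n-1)`. -/
def shiftedFactorial (x : ℝ) (n : ℕ) : ℝ := ∏ k ∈ Finset.range n, (x + k)

/-- The classical Jacobi polynomial
`p_n(x; α, β) = Γ(n+α+1) / (Γ(n+1) Γ(α+1)) · ₂F₁(-n, n+α+β+1; α+1; (1-x)/2)`. -/
def jacobi (α β : ℝ) (n : ℕ) : Polynomial ℝ :=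
  Polynomial.C (Real.Gamma (n + α + 1) / (Real.Gamma (n + 1) * Real.Gamma (α + 1))) *
    ∑ k ∈ Finset.range (n + 1),
      Polynomial.C (shiftedFactorial (-n) k * shiftedFactorial (n + α + β + 1) k /
          (shiftedFactorial (α + 1) k * (k.factorial : ℝ))) *
        (Polynomial.C (1 / 2) * (1 - Polynomial.X)) ^ k

/-- The alternant `det [p_i (x_j)]` of any polynomials `p_i` is divisible by `Δ_n(x)`. -/
theorem exists_vdm_mul_eq_alternant {R : Type*} [CommRing R] {n : ℕ} (p : Fin n → Polynomial R)
    (x : Fin n → R) :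
    ∃ Q : R, vdm x * Q = (Matrix.of fun i j => (p i).eval (x j)).det := by
  rcases subsingleton_or_nontrivial R with hR | hR
  · exact ⟨0, Subsingleton.elim _ _⟩
  set q : Polynomial R := ∏ j : Fin n, (Polynomial.X - Polynomial.C (x j)) with hq
  have hmon : q.Monic := Polynomial.monic_prod_of_monic _ _ fun j _ => Polynomial.monic_X_sub_C _
  have hdeg : q.natDegree = n := by
    rw [hq, Polynomial.natDegree_prod_of_monic _ _ fun j _ => Polynomial.monic_X_sub_C _]
    simp
  have hmod : ∀ i, ((p i) %ₘ q).degree < (n : WithBot ℕ) := fun i => by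
    have h := Polynomial.degree_modByMonic_lt (p i) hmon
    rwa [Polynomial.degree_eq_natDegree hmon.ne_zero, hdeg] at h
  have hev : ∀ i j, ((p i) %ₘ q).eval (x j) = (p i).eval (x j) := fun i j => by
    have h := congrArg (Polynomial.eval (x j)) (Polynomial.modByMonic_add_div (p i) q)
    have h0 : q.eval (x j) = 0 := by
      rw [hq, Polynomial.eval_prod]
      exact Finset.prod_eq_zero (Finset.mem_univ j) (by simp)
    simpa [h0] using h
  have hfac : (Matrix.of fun i j => (p i).eval (x j)) =
      (Matrix.of fun i (k : Fin n) => ((p i) %ₘ q).coeff k) * (Matrix.vandermonde x).transpose := by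
    ext i j
    rw [Matrix.mul_apply, Matrix.of_apply, ← hev i j, Polynomial.eval_eq_sum_degreeLTEquiv
      (Polynomial.mem_degreeLT.2 (hmod i))]
    simp [Polynomial.degreeLTEquiv, Matrix.vandermonde_apply]
  rw [hfac, Matrix.det_mul, Matrix.det_transpose, Matrix.det_vandermonde]
  exact ⟨_, mul_comm _ _⟩

/-- `det [p_{λ_i + i} (x_j)]` as a polynomial in `x`, with `λ_0 ≤ ⋯ ≤ λ_{n-1}` written in
increasing order and indexed from `0`. -/
def jacobiAlternant (α β : ℝ) {n : ℕ} (lam : Fin n → ℕ) : MvPolynomial (Fin n) ℝ :=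
  (Matrix.of fun i j : Fin n =>
    ((jacobi α β (lam i + i)).map MvPolynomial.C).eval (MvPolynomial.X j)).det

theorem exists_vdm_mul_eq_jacobiAlternant (α β : ℝ) {n : ℕ} (lam : Fin n → ℕ) :
    ∃ Q : MvPolynomial (Fin n) ℝ, vdm MvPolynomial.X * Q = jacobiAlternant α β lam :=
  exists_vdm_mul_eq_alternant (fun i => (jacobi α β (lam i + i)).map MvPolynomial.C)
    MvPolynomial.X

/-- The multivariate Jacobi polynomial `det [p_{λ_i + i} (x_j)] / Δ_n(x)`: the unique polynomial
whose product with `Δ_n(x)` is the determinant. -/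
def multiJacobi (α β : ℝ) {n : ℕ} (lam : Fin n → ℕ) : MvPolynomial (Fin n) ℝ :=
  (exists_vdm_mul_eq_jacobiAlternant α β lam).choose

theorem vdm_mul_multiJacobi (α β : ℝ) {n : ℕ} (lam : Fin n → ℕ) :
    vdm MvPolynomial.X * multiJacobi α β lam = jacobiAlternant α β lam :=
  (exists_vdm_mul_eq_jacobiAlternant α β lam).choose_spec

/-- The value of the multivariate Jacobi polynomial at `1_n = (1, …, 1)`. -/
def multiJacobiAtOne (α β : ℝ) {n : ℕ} (lam : Fin n → ℕ) : ℝ :=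
  MvPolynomial.eval (fun _ => 1) (multiJacobi α β lam)

/-- `c_{λ,n} = Γ(α+1)^n ∏ Γ(λ_i + i + 1) / Γ(λ_i + i + α + 1)`, `λ` in increasing order with
indices starting from `0`. -/
def branchC (α : ℝ) {n : ℕ} (lam : Fin n → ℕ) : ℝ :=
  Real.Gamma (α + 1) ^ n * ∏ i : Fin n,
    Real.Gamma (lam i + (i : ℕ) + 1) / Real.Gamma (lam i + (i : ℕ) + α + 1)

/-- `(2l+α+β+1) Γ(l+α+β+1)`. For `l = 0` this is `Γ(α+β+2)`, which is also the value by continuity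
when `α + β + 1 = 0`. -/
def branchWeight (α β : ℝ) (l : ℕ) : ℝ :=
  if l = 0 then Real.Gamma (α + β + 2) else (2 * l + α + β + 1) * Real.Gamma (l + α + β + 1)

/-- `B(m,l)`. -/
def branchB (α β : ℝ) (m l : ℕ) : ℝ :=
  ((2 * m + α + β + 2) * Real.Gamma (m + β + 1) * (m.factorial : ℝ) *
      branchWeight α β l * Real.Gamma (l + α + 1)) /
    (2 * Real.Gamma (m + α + β + 2) * Real.Gamma (m + α + 2) *
      Real.Gamma (l + β + 1) * (l.factorial : ℝ))

/-- `A_{μ,ν} = ∏ B(μ_i + i, ν_i + i)`, tuples in increasing order with indices starting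
from `0`. -/
def branchA (α β : ℝ) {N : ℕ} (mu nu : Fin N → ℕ) : ℝ :=
  ∏ i : Fin N, branchB α β (mu i + i) (nu i + i)

/-- `x_1 ≤ y_1 ≤ x_2 ≤ ⋯ ≤ y_N ≤ x_{N+1}`. -/
def Interlaces {R : Type*} [LE R] {N : ℕ} (x : Fin (N + 1) → R) (y : Fin N → R) : Prop :=
  ∀ i : Fin N, x i.castSucc ≤ y i ∧ y i ≤ x i.succ

/-- `0 ≤ y_1 ≤ x_1 ≤ y_2 ≤ ⋯ ≤ y_N ≤ x_N`. -/
def InterlacesZero {R : Type*} [LE R] [Zero R] {N : ℕ} (x y : Fin N → R) : Prop :=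
  (∀ i, 0 ≤ y i) ∧ (∀ i, y i ≤ x i) ∧ ∀ i j : Fin N, (i : ℕ) + 1 = j → x i ≤ y j

open scoped Classical in
/-- The discrete branching kernel `L^{N+1}_{N,α,β}(λ, ν)`: the sum runs over all `μ` with
`λ_1 ≤ μ_1 ≤ λ_2 ≤ ⋯ ≤ μ_N ≤ λ_{N+1}` and `0 ≤ ν_1 ≤ μ_1 ≤ ν_2 ≤ ⋯ ≤ ν_N ≤ μ_N`. -/
def jacobiKernel (α β : ℝ) {N : ℕ} (lam : Fin (N + 1) → ℕ) (nu : Fin N → ℕ) : ℝ :=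
  ∑ mu ∈ (Fintype.piFinset fun i : Fin N => Finset.Icc (lam i.castSucc) (lam i.succ)) with
      InterlacesZero mu nu,
    branchC α nu / branchC α lam * branchA α β mu nu *
      (multiJacobiAtOne α β nu / multiJacobiAtOne α β lam)

/-- The law `L^{N+1}_{N,α,β}(λ, ·)`. -/
def jacobiLaw (α β : ℝ) {N : ℕ} (lam : DiscreteChamber (N + 1)) : Measure (DiscreteChamber N) :=
  Measure.sum fun nu => ENNReal.ofReal (jacobiKernel α β lam.1 nu.1) • Measure.dirac nu

/-- The density
`2^{2N} N! (α+1)_N Δ_N(ν²)/Δ_{N+1}(λ²) ∫ 1[0 ≤ ν_1 ≤ μ_1 ≤ ⋯ ≤ ν_N ≤ μ_N] ∏ (ν_k/μ_k)^{2α+1} dμ`,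
the integral being over all `μ` that interlace with `λ`. -/
def limitDensity (α : ℝ) {N : ℕ} (lam : Fin (N + 1) → ℝ) (nu : Fin N → ℝ) : ℝ :=
  2 ^ (2 * N) * (N.factorial : ℝ) * shiftedFactorial (α + 1) N *
    (vdm (fun i => nu i ^ 2) / vdm (fun i => lam i ^ 2)) *
    ∫ mu in {mu : Fin N → ℝ | Interlaces lam mu},
      {nu : Fin N → ℝ | InterlacesZero mu nu}.indicator
        (fun nu => ∏ k, nu k ^ (2 * α + 1) / mu k ^ (2 * α + 1)) nu

/-- The measure on `ℝ^N` with density `limitDensity α lam`. -/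
def limitMeasure (α : ℝ) {N : ℕ} (lam : Fin (N + 1) → ℝ) : Measure (Fin N → ℝ) :=
  volume.withDensity fun nu => ENNReal.ofReal (limitDensity α lam nu)

/-- The density of `Λ^{N+1}_{α,N}(x, ·)` at `y`, with the conventions `x_0 = 0`,
`y_{N+1} = ∞` (tuples are indexed from `0` here). -/
def kernelDensity (α : ℝ) {N : ℕ} (x : Fin (N + 1) → ℝ) (y : Fin N → ℝ) : ℝ :=
  (N.factorial : ℝ) * shiftedFactorial (α + 1) N * (vdm y / vdm x) *
    ∏ k : Fin N,
      (Set.Icc (if (k : ℕ) = 0 then 0 else x ⟨k - 1, by omega⟩) (x k.succ)).indicator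
        (fun t => ∫ z in (max (x k.castSucc) t)..(if h : (k : ℕ) + 1 < N
            then min (x k.succ) (y ⟨k + 1, h⟩) else x k.succ), t ^ α / z ^ (α + 1)) (y k)

/-- The kernel `Λ^{N+1}_{α,N}(x, ·)`, a measure on `{y : 0 ≤ y_1 ≤ ⋯ ≤ y_N}`, regarded as a
measure on `ℝ^N`. -/
def lambdaKernel (α : ℝ) {N : ℕ} (x : Fin (N + 1) → ℝ) : Measure (Fin N → ℝ) :=
  (volume.restrict {y : Fin N → ℝ | (∀ i, 0 ≤ y i) ∧ Monotone y}).withDensity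
    fun y => ENNReal.ofReal (kernelDensity α x y)

end

end JacobiBranching

open JacobiBranching

namespace JacobiBranching

/-! Put `s = α + β + 1` and `θ(x) = x (x + s)`. Expanded at the point 1, the Jacobi polynomial of
degree `l` has as `k`-th Taylor coefficient its value at 1, times a factor depending on `k` alone,
times a monic polynomial of degree `k` in `θ(l)` (`jacobi_eq_sum`). An alternant quotient at a
confluent point is a determinant of Taylor coefficients, so the multivariate polynomial at `1_n` is
a product of one-variable values times the Vandermonde product of the nodes `θ(λ_i + i)`
(`multiJacobiAtOne_eq`). The constants `c` cancel the one-variable values, and the kernel becomes a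
constant times `Δ(θ(ν)) / Δ(θ(λ))` times the sum of `A` over `μ` (`jacobiKernel_eq`).

For the total mass, a determinant whose `i`-th row depends only on the `i`-th variable is summed
over an interlacing box row by row, and the result is again a determinant (`sum_box_det`). Since
`B(m,l) = U(m) V(l)`, only one-variable sums remain, and both telescope: the `V`-weighted sum over
`l` turns the parameter `s` into `s + 1` (`branchU_mul_sum`), and the sum over `m` turns it back
into `s` while raising the degree by one (`quadFactorial_succ_sub`). What comes out is the
Vandermonde product of `λ`, which cancels.

The limit is taken for the pair `(μ, ν)`. Spreading each lattice point over a cube of side `1/κ`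
gives a probability density on a product of orthants, which converges almost everywhere to
`jointDensity`, by `U(m) ~ m^{-(2α+1)}`, `V(l) ~ 2 l^{2α+1}` and `θ(κx) ~ κ² x²`. The same
determinant computation with integrals of powers shows that the limit has mass one
(`lintegral_jointDensity`). Scheffé's argument then gives convergence of integrals, and integrating
out `μ` gives `M_λ`.

For the last part, with `ν` fixed the conditions on the `μ_k` decouple, so the `μ`-integral is a
product of one-dimensional integrals; the substitutions `z = μ²`, `y = ν²` turn it into the density
of `Λ` (`limitDensity_eq`). -/

/-! ### Alternant quotients at a confluent point -/

/-- Evaluation at the `x_j` sees only the remainder modulo `∏ (X - x_j)`, which has degree below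
`n`; so the matrix factors as remainder coefficients times a transposed Vandermonde matrix. The
cofactor is explicit, and it still makes sense when the points coincide. -/
theorem alternant_eq_vdm_mul_det_coeff {R : Type*} [CommRing R] [Nontrivial R] {n : ℕ}
    (p : Fin n → Polynomial R) (x : Fin n → R) :
    (Matrix.of fun i j => (p i).eval (x j)).det = vdm x * (Matrix.of fun i (k : Fin n) =>
      ((p i) %ₘ ∏ j : Fin n, (Polynomial.X - Polynomial.C (x j))).coeff k).det := by
  set q : Polynomial R := ∏ j : Fin n, (Polynomial.X - Polynomial.C (x j)) with hq
  have hmon : q.Monic := Polynomial.monic_prod_of_monic _ _ fun j _ => Polynomial.monic_X_sub_C _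
  have hdeg : q.natDegree = n := by
    rw [hq, Polynomial.natDegree_prod_of_monic _ _ fun j _ => Polynomial.monic_X_sub_C _]
    simp
  have hmod : ∀ i, ((p i) %ₘ q).degree < (n : WithBot ℕ) := fun i => by
    have h := Polynomial.degree_modByMonic_lt (p i) hmon
    rwa [Polynomial.degree_eq_natDegree hmon.ne_zero, hdeg] at h
  have hev : ∀ i j, ((p i) %ₘ q).eval (x j) = (p i).eval (x j) := fun i j => by
    have h := congrArg (Polynomial.eval (x j)) (Polynomial.modByMonic_add_div (p i) q)
    have h0 : q.eval (x j) = 0 := by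
      rw [hq, Polynomial.eval_prod]
      exact Finset.prod_eq_zero (Finset.mem_univ j) (by simp)
    simpa [h0] using h
  have hfac : (Matrix.of fun i j => (p i).eval (x j)) =
      (Matrix.of fun i (k : Fin n) => ((p i) %ₘ q).coeff k) * (Matrix.vandermonde x).transpose := by
    ext i j
    rw [Matrix.mul_apply, Matrix.of_apply, ← hev i j, Polynomial.eval_eq_sum_degreeLTEquiv
      (Polynomial.mem_degreeLT.2 (hmod i))]
    simp [Polynomial.degreeLTEquiv, Matrix.vandermonde_apply]
  rw [hfac, Matrix.det_mul, Matrix.det_transpose, Matrix.det_vandermonde, mul_comm]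
  rfl

theorem vdm_X_ne_zero (n : ℕ) : vdm (MvPolynomial.X : Fin n → MvPolynomial (Fin n) ℝ) ≠ 0 := by
  refine Finset.prod_ne_zero_iff.2 fun i _ => Finset.prod_ne_zero_iff.2 fun j hj => ?_
  rw [sub_ne_zero]
  exact fun h => (Finset.mem_Ioi.1 hj).ne' (MvPolynomial.X_injective h)

/-- The value at `(c, …, c)` of the quotient of an alternant by the Vandermonde product is the
determinant of the Taylor coefficients at `c`. -/
theorem eval_alternant_quotient {n : ℕ} (c : ℝ) (p q : Fin n → Polynomial ℝ)
    (a : Fin n → Fin n → ℝ)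
    (h : ∀ i, p i = ∑ k : Fin n, Polynomial.C (a i k) * (Polynomial.X - Polynomial.C c) ^ (k : ℕ)
      + (Polynomial.X - Polynomial.C c) ^ n * q i)
    (Q : MvPolynomial (Fin n) ℝ)
    (hQ : vdm MvPolynomial.X * Q =
      (Matrix.of fun i j => ((p i).map MvPolynomial.C).eval (MvPolynomial.X j)).det) :
    MvPolynomial.eval (fun _ => c) Q = (Matrix.of a).det := by
  -- With indeterminates as points the Vandermonde product can be cancelled, so `Q` is the
  -- determinant of remainder coefficients. Specialising all points to `c` turns the modulus into
  -- `(X - c)^n` and the remainder into the truncated Taylor expansion.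
  rw [alternant_eq_vdm_mul_det_coeff] at hQ
  rw [mul_left_cancel₀ (vdm_X_ne_zero n) hQ, RingHom.map_det]
  have hr : ∀ i, p i %ₘ (Polynomial.X - Polynomial.C c) ^ n =
      ∑ k : Fin n, Polynomial.C (a i k) * (Polynomial.X - Polynomial.C c) ^ (k : ℕ) := fun i => by
    refine (Polynomial.div_modByMonic_unique (q i) _ ((Polynomial.monic_X_sub_C c).pow n)
      ⟨(h i).symm, ?_⟩).2
    rw [Polynomial.degree_pow, Polynomial.degree_X_sub_C, nsmul_one]
    refine (Polynomial.degree_sum_le _ _).trans_lt ((Finset.sup_lt_iff (WithBot.bot_lt_coe n)).2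
      fun k _ => ?_)
    refine lt_of_le_of_lt ?_ (WithBot.coe_lt_coe.2 k.2)
    refine Polynomial.degree_le_of_natDegree_le ((Polynomial.natDegree_C_mul_le _ _).trans ?_)
    rw [Polynomial.natDegree_pow, Polynomial.natDegree_X_sub_C, mul_one]
  have hfac : (MvPolynomial.eval fun _ : Fin n => c).mapMatrix (Matrix.of fun i (k : Fin n) =>
      ((p i).map MvPolynomial.C %ₘ
        ∏ j : Fin n, (Polynomial.X - Polynomial.C (MvPolynomial.X j))).coeff k) =
      Matrix.of a * Matrix.of fun (k j : Fin n) =>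
        ((Polynomial.X - Polynomial.C c : Polynomial ℝ) ^ (k : ℕ)).coeff j := by
    ext i j
    rw [RingHom.mapMatrix_apply, Matrix.map_apply, Matrix.of_apply, ← Polynomial.coeff_map,
      Polynomial.map_modByMonic _ (Polynomial.monic_prod_of_monic _ _
        fun j _ => Polynomial.monic_X_sub_C _), Polynomial.map_map, Polynomial.map_prod,
      show (MvPolynomial.eval fun _ : Fin n => c).comp MvPolynomial.C = RingHom.id ℝ by ext; simp]
    simp [Polynomial.map_id, hr, Matrix.mul_apply]
  -- The change of basis from `(X - c)^k` to `X^j` is unitriangular, so it does not affect the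
  -- determinant.
  rw [hfac, Matrix.det_mul, Matrix.det_of_isLowerTriangular (Matrix.of fun (k j : Fin n) =>
      ((Polynomial.X - Polynomial.C c : Polynomial ℝ) ^ (k : ℕ)).coeff j), Finset.prod_eq_one,
      mul_one]
  · intro k _
    have := ((Polynomial.monic_X_sub_C c).pow (k : ℕ)).coeff_natDegree
    simpa [Polynomial.natDegree_pow] using this
  · intro k j hkj
    refine Polynomial.coeff_eq_zero_of_natDegree_lt ?_
    change ((Polynomial.X - Polynomial.C c : Polynomial ℝ) ^ (k : ℕ)).natDegree < j
    rw [Polynomial.natDegree_pow, Polynomial.natDegree_X_sub_C, mul_one]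
    simpa using hkj

/-! ### Factorial polynomials in `x (x + s)` and the value at `1_n` -/

/-- The polynomial `∏_{k<j} (x - k) (x + k + s)`, which is monic of degree `j` in `x (x + s)`. -/
noncomputable def quadFactorial (s : ℝ) (j : ℕ) (x : ℝ) : ℝ :=
  ∏ k ∈ Finset.range j, (x - k) * (x + k + s)

/-- The quadratic function `x (x + s)`. -/
def quadNode (s x : ℝ) : ℝ := x * (x + s)

theorem quadFactorial_succ (s : ℝ) (j : ℕ) (x : ℝ) :
    quadFactorial s (j + 1) x = quadFactorial s j x * ((x - j) * (x + j + s)) :=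
  Finset.prod_range_succ _ _

@[simp] theorem quadFactorial_zero (s x : ℝ) : quadFactorial s 0 x = 1 := rfl

theorem quadFactorial_eq_zero {s : ℝ} {j l : ℕ} (h : l < j) : quadFactorial s j l = 0 :=
  Finset.prod_eq_zero (Finset.mem_range.2 h) (by simp)

theorem quadFactorial_succ_eq (s : ℝ) (j : ℕ) (x : ℝ) :
    quadFactorial s (j + 1) x = (x - j) * (x + s) * quadFactorial (s + 1) j x := by
  induction j with
  | zero => simp [quadFactorial]
  | succ j ih => rw [quadFactorial_succ, ih, quadFactorial_succ]; push_cast; ring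

theorem quadFactorial_succ_add_one (s : ℝ) (j : ℕ) (x : ℝ) :
    quadFactorial s (j + 1) (x + 1) = (x + 1) * (x + s + j + 1) * quadFactorial (s + 1) j x := by
  induction j with
  | zero => simp only [quadFactorial, Finset.prod_range_succ, Finset.prod_range_zero]; push_cast; ring
  | succ j ih => rw [quadFactorial_succ, ih, quadFactorial_succ]; push_cast; ring

/-- The quadratic analogue of `Δ x^{(j+1)} = (j+1) x^{(j)}` for falling factorials: at `x` and at `x
+ 1` the product shares the factor `quadFactorial (s + 1) j x`. This makes the sum over `μ`
telescope. -/
theorem quadFactorial_succ_sub (s : ℝ) (j : ℕ) (x : ℝ) :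
    quadFactorial s (j + 1) (x + 1) - quadFactorial s (j + 1) x =
      (j + 1) * ((2 * x + s + 1) * quadFactorial (s + 1) j x) := by
  rw [quadFactorial_succ_add_one, quadFactorial_succ_eq]; ring

theorem add_mul_quadFactorial (s : ℝ) (j : ℕ) (x : ℝ) :
    (x + s) * quadFactorial (s + 1) j x = (x + s + j) * quadFactorial s j x := by
  induction j with
  | zero => simp
  | succ j ih =>
    rw [quadFactorial_succ, quadFactorial_succ, ← mul_assoc, ih]; push_cast; ring

theorem add_one_mul_quadFactorial (s : ℝ) (j : ℕ) (x : ℝ) :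
    (x + 1) * quadFactorial (s + 1) j x = (x + 1 - j) * quadFactorial s j (x + 1) := by
  induction j with
  | zero => simp
  | succ j ih =>
    rw [quadFactorial_succ, quadFactorial_succ, ← mul_assoc, ih]; push_cast; ring

/-- Each factor `(x - k)(x + k + s)` equals `θ(x) - θ(k)`, so column `j` is a monic polynomial of
degree `j` in `θ(x_i)`. -/
theorem det_quadFactorial (s : ℝ) {n : ℕ} (x : Fin n → ℝ) :
    (Matrix.of fun i j : Fin n => quadFactorial s j (x i)).det =
      vdm fun i => quadNode s (x i) := by
  have h := Matrix.det_eval_matrixOfPolynomials_eq_det_vandermonde (fun i => quadNode s (x i))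
    (fun j : Fin n => ∏ k ∈ Finset.range j, (Polynomial.X - Polynomial.C (quadNode s k)))
    (fun j => by
      rw [Polynomial.natDegree_prod_of_monic _ _ fun j _ => Polynomial.monic_X_sub_C _]
      simp)
    (fun j => Polynomial.monic_prod_of_monic _ _ fun j _ => Polynomial.monic_X_sub_C _)
  rw [Matrix.det_vandermonde] at h
  refine Eq.trans ?_ h.symm
  congr 1
  ext i j
  simp only [Matrix.of_apply, quadFactorial, Polynomial.eval_prod, Polynomial.eval_sub,
    Polynomial.eval_X, Polynomial.eval_C, quadNode]
  exact Finset.prod_congr rfl fun k _ => by ring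

theorem quadFactorial_eq_shiftedFactorial (s : ℝ) (k : ℕ) (x : ℝ) :
    shiftedFactorial (-x) k * shiftedFactorial (x + s) k = (-1) ^ k * quadFactorial s k x := by
  induction k with
  | zero => simp [shiftedFactorial]
  | succ k ih =>
    have h1 : ∀ y : ℝ, shiftedFactorial y (k + 1) = shiftedFactorial y k * (y + k) :=
      fun y => Finset.prod_range_succ _ _
    rw [h1, h1, quadFactorial_succ, pow_succ]
    linear_combination (-x + k) * (x + s + k) * ih

/-- The value `p_n(1)` of the Jacobi polynomial. -/
noncomputable def jacobiOne (α : ℝ) (n : ℕ) : ℝ :=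
  Real.Gamma (n + α + 1) / (Real.Gamma (n + 1) * Real.Gamma (α + 1))

/-- The normalisation `∏_{k<n} 2^k (α+1)_k k!`. -/
noncomputable def taylorNorm (α : ℝ) (n : ℕ) : ℝ :=
  ∏ k : Fin n, 2 ^ (k : ℕ) * (shiftedFactorial (α + 1) k * ((k : ℕ).factorial : ℝ))

/-- The length `M` is free because `quadFactorial` vanishes at `l` for `k > l`; this allows Taylor
expansions of different degrees to be cut at the same order. -/
theorem jacobi_eq_sum (α β : ℝ) (l M : ℕ) (h : l + 1 ≤ M) :
    jacobi α β l = ∑ k ∈ Finset.range M, Polynomial.C (jacobiOne α l *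
      ((2 ^ k * (shiftedFactorial (α + 1) k * (k.factorial : ℝ)))⁻¹ *
        quadFactorial (α + β + 1) k l)) * (Polynomial.X - Polynomial.C 1) ^ k := by
  rw [← Finset.sum_subset (Finset.range_subset_range.2 h) (fun k _ hk => by
    rw [quadFactorial_eq_zero (by simpa using hk)]; simp)]
  rw [jacobi, Finset.mul_sum]
  refine Finset.sum_congr rfl fun k _ => ?_
  have h1 : (Polynomial.C (1 / 2 : ℝ) * (1 - Polynomial.X)) ^ k =
      Polynomial.C ((-1) ^ k * (2 ^ k)⁻¹ : ℝ) * (Polynomial.X - Polynomial.C 1) ^ k := by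
    rw [show Polynomial.C (1 / 2 : ℝ) * (1 - Polynomial.X) =
      Polynomial.C (-1 * 2⁻¹ : ℝ) * (Polynomial.X - Polynomial.C 1) by simp; ring, mul_pow,
      ← Polynomial.C_pow, mul_pow, inv_pow]
  have h2 := quadFactorial_eq_shiftedFactorial (α + β + 1) k l
  rw [show (l : ℝ) + (α + β + 1) = l + α + β + 1 by ring] at h2
  rw [h1, h2, ← mul_assoc, ← mul_assoc, ← Polynomial.C_mul, ← Polynomial.C_mul]
  congr 2
  have h3 : ((-1 : ℝ) ^ k) * (-1) ^ k = 1 := by rw [← mul_pow]; simp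
  rw [jacobiOne, mul_assoc, mul_inv]
  congr 1
  rw [div_eq_mul_inv]
  linear_combination (quadFactorial (α + β + 1) k l * (shiftedFactorial (α + 1) k * (k.factorial : ℝ))⁻¹ * (2 ^ k)⁻¹) * h3

theorem multiJacobiAtOne_eq (α β : ℝ) {n : ℕ} (lam : Fin n → ℕ) :
    multiJacobiAtOne α β lam = (∏ i : Fin n, jacobiOne α (lam i + i)) * (taylorNorm α n)⁻¹ *
      vdm fun i => quadNode (α + β + 1) ((lam i + i : ℕ) : ℝ) := by
  set a : Fin n → ℕ → ℝ := fun i k => jacobiOne α (lam i + i) *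
      ((2 ^ k * (shiftedFactorial (α + 1) k * (k.factorial : ℝ)))⁻¹ *
        quadFactorial (α + β + 1) k (lam i + i : ℕ)) with ha
  have h := eval_alternant_quotient 1 (fun i => jacobi α β (lam i + i))
    (fun i => ∑ k ∈ Finset.range (lam i + i + 1), Polynomial.C (a i (n + k)) *
      (Polynomial.X - Polynomial.C 1) ^ k) (fun i k => a i k) (fun i => by
        rw [jacobi_eq_sum α β _ (n + (lam i + i + 1)) (by omega), Finset.sum_range_add,
          Finset.sum_range, Finset.mul_sum]
        congr 1
        refine Finset.sum_congr rfl fun k _ => ?_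
        rw [pow_add (_ - _)]
        exact mul_left_comm _ _ _) (multiJacobi α β lam) (vdm_mul_multiJacobi α β lam)
  rw [multiJacobiAtOne, h, ← det_quadFactorial, taylorNorm, ← Finset.prod_inv_distrib]
  have h1 := Matrix.det_mul_row (fun k : Fin n =>
    (2 ^ (k : ℕ) * (shiftedFactorial (α + 1) k * ((k : ℕ).factorial : ℝ)))⁻¹)
    (Matrix.of fun i j : Fin n => quadFactorial (α + β + 1) j ((lam i + i : ℕ) : ℝ))
  have h2 := Matrix.det_mul_column (fun i : Fin n => jacobiOne α (lam i + i))
    (Matrix.of fun i j : Fin n =>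
      (2 ^ (j : ℕ) * (shiftedFactorial (α + 1) j * ((j : ℕ).factorial : ℝ)))⁻¹ *
        quadFactorial (α + β + 1) j ((lam i + i : ℕ) : ℝ))
  simp only [Matrix.of_apply] at h1 h2
  rw [mul_assoc, ← h1, ← h2]

/-! ### Determinants summed over interlacing boxes -/

theorem det_cons_one {n : ℕ} (G : Fin (n + 1) → Fin n → ℝ) :
    (Matrix.of fun i : Fin (n + 1) => (Fin.cons 1 (G i) : Fin (n + 1) → ℝ)).det =
      (Matrix.of fun i j : Fin n => G i.succ j - G i.castSucc j).det := by
  rw [Matrix.det_eq_of_forall_row_eq_smul_add_pred (B := Matrix.of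
    (Fin.cons (Fin.cons 1 (G 0)) fun i => Fin.cons 0 fun j => G i.succ j - G i.castSucc j))
    (fun _ => 1) (fun j => by simp) (fun i j => by refine Fin.cases ?_ (fun j => ?_) j <;> simp),
    Matrix.det_succ_column_zero, Fin.sum_univ_succ]
  simp only [Matrix.of_apply, Fin.cons_zero, Fin.cons_succ, mul_zero, zero_mul,
    Finset.sum_const_zero, add_zero]
  simp [Matrix.submatrix, Matrix.of_apply]

theorem det_cons_one_zero {n : ℕ} (G : Fin (n + 1) → Fin n → ℝ) (h : ∀ j, G 0 j = 0) :
    (Matrix.of fun i : Fin (n + 1) => (Fin.cons 1 (G i) : Fin (n + 1) → ℝ)).det =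
      (Matrix.of fun i j : Fin n => G i.succ j).det := by
  rw [Matrix.det_succ_row_zero, Fin.sum_univ_succ]
  simp [Matrix.submatrix, h]

/-- Prepending the node `0` reduces the second kind of interlacing to the first, so one summation
lemma serves for both `μ` and `ν`. -/
theorem interlacesZero_iff {R : Type*} [Preorder R] [Zero R] {N : ℕ} {mu nu : Fin N → R}
    (hmu : ∀ i, 0 ≤ mu i) :
    InterlacesZero mu nu ↔ Interlaces (Fin.cons 0 mu : Fin (N + 1) → R) nu := by
  constructor
  · rintro ⟨h0, h1, h2⟩ i
    refine ⟨?_, by simpa using h1 i⟩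
    cases N with
    | zero => exact i.elim0
    | succ n =>
      refine Fin.cases ?_ (fun j => ?_) i
      · simpa using h0 0
      · rw [Fin.castSucc_succ, Fin.cons_succ]
        exact h2 _ _ (by simp)
  · intro h
    have h2 : ∀ i j : Fin N, (i : ℕ) + 1 = j → mu i ≤ nu j := fun i j hij => by
      have h3 : j.castSucc = i.succ := Fin.ext (by simp [hij])
      simpa [h3] using (h j).1
    refine ⟨fun i => ?_, fun i => by simpa using (h i).2, h2⟩
    by_cases hi : (i : ℕ) = 0
    · have h3 : i.castSucc = 0 := Fin.ext (by simp [hi])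
      simpa [h3] using (h i).1
    · exact (hmu ⟨i - 1, by omega⟩).trans (h2 _ _ (by simp; omega))

theorem Interlaces.monotone {R : Type*} [Preorder R] {N : ℕ} {x : Fin (N + 1) → R} {y : Fin N → R}
    (h : Interlaces x y) : Monotone y := by
  cases N with
  | zero => exact fun i => i.elim0
  | succ n =>
    refine Fin.monotone_iff_le_succ.2 fun i => (h i.castSucc).2.trans ?_
    have := (h i.succ).1
    rwa [Fin.castSucc_succ] at this

theorem InterlacesZero.monotone {R : Type*} [Preorder R] [Zero R] {N : ℕ} {mu nu : Fin N → R}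
    (h : InterlacesZero mu nu) : Monotone nu :=
  ((interlacesZero_iff fun i => (h.1 i).trans (h.2.1 i)).1 h).monotone

/-- By multilinearity the sum enters each row separately; row `i` becomes a difference of partial
sums at two consecutive nodes, which is the row-reduced form of the bordered determinant in
`det_cons_one`. -/
theorem sum_box_det {N : ℕ} (x : Fin (N + 1) → ℕ) (hx : Monotone x) (f : Fin N → ℕ → ℝ) :
    ∑ y ∈ Fintype.piFinset fun i : Fin N => Finset.Icc (x i.castSucc) (x i.succ),
      (Matrix.of fun i j => f j (y i + i)).det =
    (Matrix.of fun i : Fin (N + 1) => (Fin.cons 1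
      (fun j => ∑ k ∈ Finset.range (x i + i), f j k) : Fin (N + 1) → ℝ)).det := by
  have h := (Matrix.detRowAlternating (n := Fin N) (R := ℝ)).toMultilinearMap.map_sum_finset
    (fun i y j => f j (y + i)) (fun i : Fin N => Finset.Icc (x i.castSucc) (x i.succ))
  rw [det_cons_one]
  refine h.symm.trans ?_
  change Matrix.det _ = Matrix.det _
  congr 1
  ext i j
  -- After the shift by `i` the closed interval `[x_i, x_{i+1}]` becomes the half-open interval from
  -- `x_i + i` to `x_{i+1} + i + 1`, so consecutive intervals abut and never share a point.
  rw [Finset.sum_apply, Matrix.of_apply, Finset.range_eq_Ico, Finset.range_eq_Ico,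
    ← Finset.sum_Ico_consecutive (f j) (Nat.zero_le (x i.castSucc + i.castSucc))
      (Nat.add_le_add (hx (Fin.castSucc_lt_succ (i := i)).le) (by simp)), add_sub_cancel_left,
    Fin.val_succ, Fin.val_castSucc, ← add_assoc, add_right_comm,
    ← Finset.sum_Ico_add' (f j) (x i.castSucc) (x i.succ + 1) i]
  rfl

/-! ### The discrete kernel is Markov -/

/-- The nodes `θ(λ_i + i)` with `θ(x) = x (x + s)`. -/
def nodes (s : ℝ) {n : ℕ} (lam : Fin n → ℕ) : Fin n → ℝ :=
  fun i => quadNode s ((lam i + i : ℕ) : ℝ)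

theorem vdm_nonneg {n : ℕ} {x : Fin n → ℝ} (hx : Monotone x) : 0 ≤ vdm x :=
  Finset.prod_nonneg fun _ _ => Finset.prod_nonneg fun _ hj =>
    sub_nonneg.2 (hx (Finset.mem_Ioi.1 hj).le)

theorem vdm_pos {n : ℕ} {x : Fin n → ℝ} (hx : StrictMono x) : 0 < vdm x :=
  Finset.prod_pos fun _ _ => Finset.prod_pos fun _ hj => sub_pos.2 (hx (Finset.mem_Ioi.1 hj))

/-- `θ(y) - θ(x) = (y - x)(x + y + s)`, and distinct natural numbers have `x + y ≥ 1 > -s`. -/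
theorem nodes_strictMono {s : ℝ} (hs : -1 < s) {n : ℕ} {lam : Fin n → ℕ} (h : Monotone lam) :
    StrictMono (nodes s lam) := fun i j hij => by
  have h1 : lam i + i + 1 ≤ lam j + j := by
    have := h hij.le
    have : (i : ℕ) < j := hij
    omega
  have h2 : ((lam i + i : ℕ) : ℝ) + 1 ≤ ((lam j + j : ℕ) : ℝ) := by exact_mod_cast h1
  have h3 : (0 : ℝ) ≤ ((lam i + i : ℕ) : ℝ) := Nat.cast_nonneg _
  simp only [nodes, quadNode]
  generalize ((lam i + i : ℕ) : ℝ) = x at *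
  generalize ((lam j + j : ℕ) : ℝ) = y at *
  nlinarith [mul_pos (show 0 < y - x by linarith) (show 0 < y + x + s by linarith)]

/-- The factor of `B(m,l)` that depends on `m`. -/
noncomputable def branchU (α β : ℝ) (m : ℕ) : ℝ :=
  ((2 * m + α + β + 2) * Real.Gamma (m + β + 1) * (m.factorial : ℝ)) /
    (2 * Real.Gamma (m + α + β + 2) * Real.Gamma (m + α + 2))

/-- The factor of `B(m,l)` that depends on `l`. -/
noncomputable def branchV (α β : ℝ) (l : ℕ) : ℝ :=
  (branchWeight α β l * Real.Gamma (l + α + 1)) / (Real.Gamma (l + β + 1) * (l.factorial : ℝ))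

theorem branchB_eq (α β : ℝ) (m l : ℕ) : branchB α β m l = branchU α β m * branchV α β l := by
  rw [branchB, branchU, branchV, div_mul_div_comm]
  congr 1 <;> ring

section
variable {α β : ℝ} (hα : -1 < α) (hβ : -1 < β)
include hα hβ

theorem branchWeight_eq (l : ℕ) (hl : l ≠ 0) : branchWeight α β l =
    (2 * l + α + β + 1) / (l + α + β + 1) * Real.Gamma (l + α + β + 2) := by
  have h1 : (1 : ℝ) ≤ l := by exact_mod_cast Nat.one_le_iff_ne_zero.2 hl
  have h0 : (l : ℝ) + α + β + 1 ≠ 0 := by linarith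
  rw [branchWeight, if_neg hl, show (l : ℝ) + α + β + 2 = l + α + β + 1 + 1 by ring,
    Real.Gamma_add_one h0]
  field_simp

theorem branchU_pos (m : ℕ) : 0 < branchU α β m := by
  have h : (0 : ℝ) ≤ m := m.cast_nonneg
  have h1 := Real.Gamma_pos_of_pos (show 0 < (m : ℝ) + β + 1 by linarith)
  have h2 := Real.Gamma_pos_of_pos (show 0 < (m : ℝ) + α + β + 2 by linarith)
  have h3 := Real.Gamma_pos_of_pos (show 0 < (m : ℝ) + α + 2 by linarith)
  have h4 : 0 < 2 * (m : ℝ) + α + β + 2 := by linarith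
  unfold branchU
  positivity

theorem branchV_pos (l : ℕ) : 0 < branchV α β l := by
  have h : (0 : ℝ) ≤ l := l.cast_nonneg
  have h1 := Real.Gamma_pos_of_pos (show 0 < (l : ℝ) + β + 1 by linarith)
  have h2 := Real.Gamma_pos_of_pos (show 0 < (l : ℝ) + α + β + 2 by linarith)
  have h3 := Real.Gamma_pos_of_pos (show 0 < (l : ℝ) + α + 1 by linarith)
  have h5 : 0 < branchWeight α β l := by
    by_cases hl : l = 0
    · rw [branchWeight, if_pos hl]
      exact Real.Gamma_pos_of_pos (by linarith)
    · have h6 : (1 : ℝ) ≤ l := by exact_mod_cast Nat.one_le_iff_ne_zero.2 hl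
      rw [branchWeight_eq hα hβ l hl]
      exact mul_pos (div_pos (by linarith) (by linarith)) h2
  unfold branchV
  positivity

theorem branchA_nonneg {N : ℕ} (mu nu : Fin N → ℕ) : 0 ≤ branchA α β mu nu :=
  Finset.prod_nonneg fun i _ => by
    rw [branchB_eq]; exact (mul_pos (branchU_pos hα hβ _) (branchV_pos hα hβ _)).le

/-- The right-hand side is a discrete antiderivative of the summand. In the induction step both
values of `quadFactorial (s + 1) j` are expressed through `quadFactorial s j (m + 1)`, after which a
rational identity remains. -/
theorem sum_quadFactorial_mul_branchV (j m : ℕ) :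
    ∑ n ∈ Finset.range (m + 1), quadFactorial (α + β + 1) j n * branchV α β n =
      (α + 1 + j)⁻¹ * (Real.Gamma (m + α + β + 2) * Real.Gamma (m + α + 2) /
        (Real.Gamma (m + β + 1) * m.factorial) * quadFactorial (α + β + 1 + 1) j m) := by
  have hj : (0 : ℝ) ≤ j := j.cast_nonneg
  have hj0 : α + 1 + (j : ℝ) ≠ 0 := by linarith
  induction m with
  | zero =>
    -- The convention for the weight at `l = 0` is what makes the telescoping start correctly when
    -- `j = 0`; for `j > 0` both sides vanish.
    rw [zero_add, Finset.sum_range_one, branchV, branchWeight, if_pos rfl]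
    rcases Nat.eq_zero_or_pos j with rfl | hj1
    · simp only [quadFactorial_zero, Nat.cast_zero, zero_add, add_zero]
      rw [show α + 2 = α + 1 + 1 by ring,
        Real.Gamma_add_one (show α + 1 ≠ 0 by linarith)]
      have := (Real.Gamma_pos_of_pos (show 0 < β + 1 by linarith)).ne'
      simp only [Nat.cast_zero, add_zero] at hj0
      field_simp
    · rw [quadFactorial_eq_zero hj1, quadFactorial_eq_zero hj1]
      simp
  | succ m ih =>
    have hm : (0 : ℝ) ≤ m := m.cast_nonneg
    rw [Finset.sum_range_succ, ih, branchV, branchWeight_eq hα hβ _ (Nat.succ_ne_zero m)]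
    have e1 := add_one_mul_quadFactorial (α + β + 1) j m
    have e2 := add_mul_quadFactorial (α + β + 1) j (m + 1 : ℝ)
    push_cast
    rw [Nat.factorial_succ]
    have g1 : Real.Gamma ((m : ℝ) + 1 + α + β + 2) =
        (m + α + β + 2) * Real.Gamma (m + α + β + 2) := by
      rw [← Real.Gamma_add_one (by linarith)]; congr 1; ring
    have g2 : Real.Gamma ((m : ℝ) + 1 + α + 2) = (m + α + 2) * Real.Gamma (m + α + 2) := by
      rw [← Real.Gamma_add_one (by linarith)]; congr 1; ring
    have g3 : Real.Gamma ((m : ℝ) + 1 + β + 1) = (m + β + 1) * Real.Gamma (m + β + 1) := by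
      rw [← Real.Gamma_add_one (by linarith)]; congr 1; ring
    have g4 : Real.Gamma ((m : ℝ) + 1 + α + 1) = Real.Gamma (m + α + 2) := by
      congr 1; ring
    rw [g1, g2, g3, g4]
    have p3 := (Real.Gamma_pos_of_pos (show 0 < (m : ℝ) + β + 1 by linarith)).ne'
    have q1 : (m : ℝ) + 1 ≠ 0 := by linarith
    have q2 : (m : ℝ) + β + 1 ≠ 0 := by linarith
    have q3 : (m : ℝ) + α + β + 2 ≠ 0 := by linarith
    have q4 : (m.factorial : ℝ) ≠ 0 := by exact_mod_cast m.factorial_ne_zero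
    have e1' : quadFactorial (α + β + 1 + 1) j m =
        (m + 1 - j) * quadFactorial (α + β + 1) j (m + 1) / (m + 1) := by
      rw [eq_div_iff q1, mul_comm, e1]
    have e2' : quadFactorial (α + β + 1 + 1) j (m + 1) =
        (m + α + β + 2 + j) * quadFactorial (α + β + 1) j (m + 1) / (m + α + β + 2) := by
      rw [eq_div_iff q3]; linear_combination e2
    rw [e1', e2', show (m : ℝ) + 1 + α + β + 1 = m + α + β + 2 by ring]
    push_cast
    field_simp
    ring

theorem branchU_mul_sum (j m : ℕ) :
    branchU α β m * ∑ n ∈ Finset.range (m + 1), quadFactorial (α + β + 1) j n * branchV α β n =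
      (2 * (α + 1 + j))⁻¹ *
        ((2 * m + (α + β + 1) + 1) * quadFactorial (α + β + 1 + 1) j m) := by
  have hj : (0 : ℝ) ≤ j := j.cast_nonneg
  have hm : (0 : ℝ) ≤ m := m.cast_nonneg
  have hj0 : α + 1 + (j : ℝ) ≠ 0 := by linarith
  have h1 := (Real.Gamma_pos_of_pos (show 0 < (m : ℝ) + β + 1 by linarith)).ne'
  have h2 := (Real.Gamma_pos_of_pos (show 0 < (m : ℝ) + α + β + 2 by linarith)).ne'
  have h3 := (Real.Gamma_pos_of_pos (show 0 < (m : ℝ) + α + 2 by linarith)).ne'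
  have q4 : (m.factorial : ℝ) ≠ 0 := by exact_mod_cast m.factorial_ne_zero
  rw [sum_quadFactorial_mul_branchV hα hβ, branchU]
  field_simp
  ring

omit hβ in
theorem jacobiOne_pos (n : ℕ) : 0 < jacobiOne α n := by
  have h : (0 : ℝ) ≤ n := n.cast_nonneg
  exact div_pos (Real.Gamma_pos_of_pos (by linarith))
    (mul_pos (Real.Gamma_pos_of_pos (by linarith)) (Real.Gamma_pos_of_pos (by linarith)))

omit hα hβ in
theorem branchC_eq {n : ℕ} (lam : Fin n → ℕ) :
    branchC α lam = (∏ i : Fin n, jacobiOne α (lam i + i))⁻¹ := by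
  rw [branchC, ← Finset.prod_inv_distrib]
  have : Real.Gamma (α + 1) ^ n = ∏ _i : Fin n, Real.Gamma (α + 1) := by simp
  rw [this, ← Finset.prod_mul_distrib]
  refine Finset.prod_congr rfl fun i _ => ?_
  rw [jacobiOne, inv_div, Nat.cast_add]
  ring

omit hβ in
theorem shiftedFactorial_pos (n : ℕ) : 0 < shiftedFactorial (α + 1) n :=
  Finset.prod_pos fun k _ => by have : (0 : ℝ) ≤ k := k.cast_nonneg; linarith

omit hβ in
theorem taylorNorm_pos (n : ℕ) : 0 < taylorNorm α n :=
  Finset.prod_pos fun k _ => mul_pos (by positivity)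
    (mul_pos (shiftedFactorial_pos hα _) (by positivity))

omit hα hβ in
theorem taylorNorm_succ (n : ℕ) : taylorNorm α (n + 1) =
    taylorNorm α n * (2 ^ n * (shiftedFactorial (α + 1) n * (n.factorial : ℝ))) := by
  simp only [taylorNorm, Fin.prod_univ_castSucc, Fin.val_castSucc, Fin.val_last]

-- The factors `c` are inverse products of the one-variable values at 1 and cancel them; the
-- quotient of the normalisations `taylorNorm` supplies the constant `2^N (α+1)_N N!`.
omit hβ in
open scoped Classical in
theorem jacobiKernel_eq {N : ℕ} (lam : Fin (N + 1) → ℕ) (nu : Fin N → ℕ) :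
    jacobiKernel α β lam nu =
      ∑ mu ∈ Fintype.piFinset fun i : Fin N => Finset.Icc (lam i.castSucc) (lam i.succ),
        if InterlacesZero mu nu then 2 ^ N * (shiftedFactorial (α + 1) N * (N.factorial : ℝ)) *
          (vdm (nodes (α + β + 1) nu) / vdm (nodes (α + β + 1) lam)) * branchA α β mu nu
        else 0 := by
  rw [jacobiKernel, Finset.sum_filter]
  refine Finset.sum_congr rfl fun mu _ => ?_
  congr 1
  rw [multiJacobiAtOne_eq, multiJacobiAtOne_eq, branchC_eq, branchC_eq, taylorNorm_succ]
  have h1 : ∏ i : Fin N, jacobiOne α (nu i + i) ≠ 0 :=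
    (Finset.prod_pos fun i _ => jacobiOne_pos hα _).ne'
  have h2 : ∏ i : Fin (N + 1), jacobiOne α (lam i + i) ≠ 0 :=
    (Finset.prod_pos fun i _ => jacobiOne_pos hα _).ne'
  have h3 := (taylorNorm_pos hα N).ne'
  have h4 := (shiftedFactorial_pos hα N).ne'
  change _ / _ * _ * (_ * _ * vdm (nodes (α + β + 1) nu) / (_ * _ * vdm (nodes (α + β + 1) lam))) = _
  generalize vdm (nodes (α + β + 1) lam) = v
  -- No ordering of `λ` is assumed here; if the Vandermonde product vanishes, both sides are zero by
  -- the convention for division by zero.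
  by_cases hv : v = 0
  · simp [hv]
  · field_simp

theorem jacobiKernel_nonneg {N : ℕ} {lam : Fin (N + 1) → ℕ} (hlam : Monotone lam)
    {nu : Fin N → ℕ} (hnu : Monotone nu) : 0 ≤ jacobiKernel α β lam nu := by
  classical
  rw [jacobiKernel_eq hα]
  refine Finset.sum_nonneg fun mu _ => ?_
  split_ifs
  · have h1 := shiftedFactorial_pos hα N
    have h2 := branchA_nonneg hα hβ mu nu
    have h3 := (vdm_pos (nodes_strictMono (s := α + β + 1) (by linarith) hlam)).le
    have h4 := (vdm_pos (nodes_strictMono (s := α + β + 1) (by linarith) hnu)).le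
    positivity
  · exact le_rfl

omit hα hβ in
theorem jacobiKernel_eq_zero {N : ℕ} {lam : Fin (N + 1) → ℕ} {nu : Fin N → ℕ}
    (h : nu ∉ (Fintype.piFinset fun i : Fin N => Finset.Icc 0 (lam i.succ)) ∨ ¬ Monotone nu) :
    jacobiKernel α β lam nu = 0 := by
  classical
  rw [jacobiKernel]
  refine Finset.sum_eq_zero fun mu hmu => ?_
  rw [Finset.mem_filter, Fintype.mem_piFinset] at hmu
  refine absurd (h.resolve_right (not_not.2 hmu.2.monotone)) (not_not.2 ?_)
  exact Fintype.mem_piFinset.2 fun i => Finset.mem_Icc.2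
    ⟨Nat.zero_le _, (hmu.2.2.1 i).trans (Finset.mem_Icc.1 (hmu.1 i)).2⟩

omit hα hβ in
theorem prod_two_mul_add_inv (N : ℕ) : ∏ j : Fin N, (2 * (α + 1 + (j : ℕ)))⁻¹ =
    (2 ^ N * shiftedFactorial (α + 1) N)⁻¹ := by
  rw [Finset.prod_inv_distrib, Finset.prod_mul_distrib, shiftedFactorial, Finset.prod_range]
  simp

/-- The sum over `ν` for fixed `μ`: the factors `V` enter the rows before summation, the factors `U`
after it. The row of the extra node `0` is `(1, 0, …, 0)` because the partial sums there are empty.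
-/
theorem sum_vdm_mul_branchA {N : ℕ} {mu : Fin N → ℕ} (hmu : Monotone mu) :
    ∑ nu ∈ Fintype.piFinset fun i : Fin N => Finset.Icc
        ((Fin.cons 0 mu : Fin (N + 1) → ℕ) i.castSucc) ((Fin.cons 0 mu : Fin (N + 1) → ℕ) i.succ),
      vdm (nodes (α + β + 1) nu) * branchA α β mu nu =
    (2 ^ N * shiftedFactorial (α + 1) N)⁻¹ * (Matrix.of fun i j : Fin N =>
      (2 * ((mu i + i : ℕ) : ℝ) + (α + β + 1) + 1) *
        quadFactorial (α + β + 1 + 1) j ((mu i + i : ℕ) : ℝ)).det := by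
  have hcons : Monotone (Fin.cons 0 mu : Fin (N + 1) → ℕ) := by
    intro i j hij
    refine Fin.cases (fun _ => by simp) (fun i => ?_) i hij
    refine Fin.cases (fun h => absurd h (by simp)) (fun j h => ?_) j
    simpa using hmu (by simpa using h)
  have h := sum_box_det (Fin.cons 0 mu : Fin (N + 1) → ℕ) hcons
    (fun j n => quadFactorial (α + β + 1) j n * branchV α β n)
  rw [det_cons_one_zero _ (by simp)] at h
  calc _ = (∏ i : Fin N, branchU α β (mu i + i)) * ∑ nu ∈ Fintype.piFinset fun i : Fin N =>
        Finset.Icc ((Fin.cons 0 mu : Fin (N + 1) → ℕ) i.castSucc)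
          ((Fin.cons 0 mu : Fin (N + 1) → ℕ) i.succ), (Matrix.of fun i j : Fin N =>
            quadFactorial (α + β + 1) j (nu i + i : ℕ) * branchV α β (nu i + i)).det := by
        rw [Finset.mul_sum]
        refine Finset.sum_congr rfl fun nu _ => ?_
        rw [show vdm (nodes (α + β + 1) nu) = _ from
          (det_quadFactorial (α + β + 1) fun i => ((nu i + i : ℕ) : ℝ)).symm, branchA]
        simp only [branchB_eq, Finset.prod_mul_distrib]
        have h3 := Matrix.det_mul_column (fun i : Fin N => branchV α β (nu i + i))
          (Matrix.of fun i j : Fin N => quadFactorial (α + β + 1) j ((nu i + i : ℕ) : ℝ))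
        simp only [Matrix.of_apply, mul_comm (branchV α β _)] at h3
        rw [h3]
        ring
    _ = _ := by
        rw [h, ← Matrix.det_mul_column, ← prod_two_mul_add_inv, ← Matrix.det_mul_row]
        congr 1
        ext i j
        simp only [Matrix.of_apply, Fin.cons_succ, Fin.val_succ]
        rw [← add_assoc, branchU_mul_sum hα hβ]

-- The sum over `μ`: by `quadFactorial_succ_sub` the partial sums are multiples of `quadFactorial s
-- (j + 1)`, and the border of ones supplies the missing degree zero, so a full Vandermonde product
-- in `N + 1` nodes appears.
omit hα hβ in
theorem sum_det_quadFactorial (s : ℝ) {N : ℕ} {lam : Fin (N + 1) → ℕ} (hlam : Monotone lam) :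
    ∑ mu ∈ Fintype.piFinset fun i : Fin N => Finset.Icc (lam i.castSucc) (lam i.succ),
      (Matrix.of fun i j : Fin N => (2 * ((mu i + i : ℕ) : ℝ) + s + 1) *
        quadFactorial (s + 1) j ((mu i + i : ℕ) : ℝ)).det =
      (N.factorial : ℝ)⁻¹ * vdm (nodes s lam) := by
  rw [sum_box_det lam hlam (fun j m => (2 * (m : ℝ) + s + 1) * quadFactorial (s + 1) j m)]
  have h1 : ∀ (j n : ℕ), ∑ m ∈ Finset.range n, (2 * (m : ℝ) + s + 1) * quadFactorial (s + 1) j m =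
      ((j : ℝ) + 1)⁻¹ * quadFactorial s (j + 1) n := fun j n => by
    have hj : (j : ℝ) + 1 ≠ 0 := by positivity
    induction n with
    | zero => rw [Finset.sum_range_zero, quadFactorial_eq_zero (Nat.succ_pos j), mul_zero]
    | succ n ih =>
      rw [Finset.sum_range_succ, ih, Nat.cast_succ,
        eq_add_of_sub_eq' (quadFactorial_succ_sub s j n)]
      field_simp
  have h2 : vdm (nodes s lam) = _ :=
    (det_quadFactorial s fun i => ((lam i + i : ℕ) : ℝ)).symm
  have h3 : (N.factorial : ℝ)⁻¹ = ∏ j : Fin (N + 1),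
      (Fin.cons 1 (fun j : Fin N => ((j : ℝ) + 1)⁻¹) : Fin (N + 1) → ℝ) j := by
    rw [Fin.prod_univ_succ]
    simp only [Fin.cons_zero, Fin.cons_succ, one_mul, Finset.prod_inv_distrib]
    rw [← Finset.prod_range_add_one_eq_factorial, Finset.prod_range]
    push_cast
    rfl
  rw [h2, h3, ← Matrix.det_mul_row]
  congr 1
  ext i j
  refine Fin.cases ?_ (fun j => ?_) j
  · simp
  · simp [h1]

open scoped Classical in
theorem sum_jacobiKernel {N : ℕ} {lam : Fin (N + 1) → ℕ} (hlam : Monotone lam) :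
    ∑ nu ∈ Fintype.piFinset fun i : Fin N => Finset.Icc 0 (lam i.succ),
      jacobiKernel α β lam nu = 1 := by
  simp only [jacobiKernel_eq hα]
  rw [Finset.sum_comm]
  have hv := (vdm_pos (nodes_strictMono (s := α + β + 1) (by linarith) hlam)).ne'
  have hsf := (shiftedFactorial_pos hα N).ne'
  calc _ = ∑ mu ∈ Fintype.piFinset fun i : Fin N => Finset.Icc (lam i.castSucc) (lam i.succ),
      (N.factorial : ℝ) * (vdm (nodes (α + β + 1) lam))⁻¹ * (Matrix.of fun i j : Fin N =>
      (2 * ((mu i + i : ℕ) : ℝ) + (α + β + 1) + 1) *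
        quadFactorial (α + β + 1 + 1) j ((mu i + i : ℕ) : ℝ)).det := by
        refine Finset.sum_congr rfl fun mu hmu => ?_
        have hI : Interlaces lam mu := fun i =>
          Finset.mem_Icc.1 (Fintype.mem_piFinset.1 hmu i)
        have hbox : (Fintype.piFinset fun i : Fin N => Finset.Icc 0 (lam i.succ)).filter
            (InterlacesZero mu) = Fintype.piFinset fun i : Fin N => Finset.Icc
              ((Fin.cons 0 mu : Fin (N + 1) → ℕ) i.castSucc)
              ((Fin.cons 0 mu : Fin (N + 1) → ℕ) i.succ) := by
          ext nu
          simp only [Finset.mem_filter, Fintype.mem_piFinset, Finset.mem_Icc]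
          rw [interlacesZero_iff fun i => Nat.zero_le _]
          refine ⟨fun h => h.2, fun h => ⟨fun i => ⟨Nat.zero_le _, ?_⟩, h⟩⟩
          have := (h i).2
          rw [Fin.cons_succ] at this
          exact this.trans (hI i).2
        rw [← Finset.sum_filter, hbox]
        have h := sum_vdm_mul_branchA hα hβ hI.monotone
        refine (Finset.sum_congr rfl fun nu _ =>
          show _ = 2 ^ N * (shiftedFactorial (α + 1) N * (N.factorial : ℝ)) *
            (vdm (nodes (α + β + 1) lam))⁻¹ * (vdm (nodes (α + β + 1) nu) * branchA α β mu nu)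
            by ring).trans ?_
        rw [← Finset.mul_sum, h]
        field_simp
    _ = 1 := by
        rw [← Finset.mul_sum, sum_det_quadFactorial _ hlam]
        have : (N.factorial : ℝ) ≠ 0 := by positivity
        field_simp

theorem hasSum_jacobiKernel {N : ℕ} {lam : Fin (N + 1) → ℕ} (hlam : Monotone lam) :
    HasSum (jacobiKernel α β lam) 1 := by
  rw [← sum_jacobiKernel hα hβ hlam]
  exact hasSum_sum_of_ne_finset_zero fun nu hnu => jacobiKernel_eq_zero (Or.inl hnu)

theorem hasSum_jacobiKernel_subtype {N : ℕ} {lam : Fin (N + 1) → ℕ} (hlam : Monotone lam) :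
    HasSum (fun nu : DiscreteChamber N => jacobiKernel α β lam nu.1) 1 := by
  have h : Function.support (jacobiKernel α β lam) ⊆ {nu : Fin N → ℕ | Monotone nu} :=
    fun nu hnu => by_contra fun h => hnu (jacobiKernel_eq_zero (Or.inr h))
  exact (hasSum_subtype_iff_of_support_subset h).2 (hasSum_jacobiKernel hα hβ hlam)

end

/-! ### The substitution of squares -/

/-- The upper end point `x_{k+1} ∧ y_{k+1}`, with `y_{N+1} = ∞`. -/
noncomputable def upperEnd {N : ℕ} (x : Fin (N + 1) → ℝ) (y : Fin N → ℝ) (k : Fin N) : ℝ :=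
  if h : (k : ℕ) + 1 < N then min (x k.succ) (y ⟨k + 1, h⟩) else x k.succ

theorem upperEnd_le {N : ℕ} (x : Fin (N + 1) → ℝ) (y : Fin N → ℝ) (k : Fin N) :
    upperEnd x y k ≤ x k.succ := by
  rw [upperEnd]; split_ifs
  exacts [min_le_left _ _, le_rfl]

theorem upperEnd_le_of_eq {N : ℕ} (x : Fin (N + 1) → ℝ) (y : Fin N → ℝ) {k j : Fin N}
    (h : (k : ℕ) + 1 = j) : upperEnd x y k ≤ y j := by
  have hk : (k : ℕ) + 1 < N := h ▸ j.2
  have hj : (⟨k + 1, hk⟩ : Fin N) = j := Fin.ext h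
  rw [upperEnd, dif_pos hk, hj]
  exact min_le_right _ _

theorem interlaces_and_iff {N : ℕ} {x : Fin (N + 1) → ℝ} {m y : Fin N → ℝ} (hy : ∀ i, 0 ≤ y i) :
    Interlaces x m ∧ InterlacesZero m y ↔
      ∀ k, m k ∈ Set.Icc (max (x k.castSucc) (y k)) (upperEnd x y k) := by
  constructor
  · rintro ⟨h1, _, h3, h4⟩ k
    refine ⟨max_le (h1 k).1 (h3 k), ?_⟩
    rw [upperEnd]; split_ifs with h
    · exact le_min (h1 k).2 (h4 k _ rfl)
    · exact (h1 k).2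
  · intro h
    exact ⟨fun k => ⟨(le_max_left _ _).trans (h k).1, (h k).2.trans (upperEnd_le _ _ _)⟩, hy,
      fun k => (le_max_right _ _).trans (h k).1,
      fun i j hij => (h i).2.trans (upperEnd_le_of_eq _ _ hij)⟩

theorem measurableSet_interlaces {N : ℕ} (x : Fin (N + 1) → ℝ) :
    MeasurableSet {m : Fin N → ℝ | Interlaces x m} := by
  have : {m : Fin N → ℝ | Interlaces x m} =
      Set.univ.pi fun i : Fin N => Set.Icc (x i.castSucc) (x i.succ) := by
    ext m; simp only [Interlaces, Set.mem_pi, Set.mem_univ, true_implies]; rfl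
  rw [this]
  exact MeasurableSet.univ_pi fun _ => measurableSet_Icc

theorem indicator_box_eq_prod {N : ℕ} (S : Fin N → Set ℝ) (f : Fin N → ℝ → ℝ) (x : Fin N → ℝ)
    (p : Prop) [Decidable p] (hp : p ↔ ∀ k, x k ∈ S k) :
    (if p then ∏ k, f k (x k) else 0) = ∏ k, (S k).indicator (f k) (x k) := by
  by_cases h : p
  · rw [if_pos h]
    exact Finset.prod_congr rfl fun k _ => (Set.indicator_of_mem (hp.1 h k) _).symm
  · rw [if_neg h]
    obtain ⟨k, hk⟩ := not_forall.1 (mt hp.2 h)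
    exact (Finset.prod_eq_zero (Finset.mem_univ k) (Set.indicator_of_notMem hk _)).symm

theorem integral_interlaces_eq_prod (α : ℝ) {N : ℕ} (x : Fin (N + 1) → ℝ) {y : Fin N → ℝ}
    (hy : ∀ i, 0 ≤ y i) :
    ∫ mu in {mu : Fin N → ℝ | Interlaces x mu},
      {nu : Fin N → ℝ | InterlacesZero mu nu}.indicator
        (fun nu => ∏ k, nu k ^ (2 * α + 1) / mu k ^ (2 * α + 1)) y =
    ∏ k, ∫ m in Set.Icc (max (x k.castSucc) (y k)) (upperEnd x y k),
      y k ^ (2 * α + 1) / m ^ (2 * α + 1) := by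
  classical
  rw [← integral_indicator (measurableSet_interlaces x)]
  simp only [← integral_indicator measurableSet_Icc]
  rw [volume_pi, ← integral_fintype_prod_eq_prod]
  congr 1
  ext m
  rw [← indicator_box_eq_prod _ _ _ (Interlaces x m ∧ InterlacesZero m y) (interlaces_and_iff hy)]
  simp only [Set.indicator_apply, Set.mem_ofPred_eq, ite_and]

theorem rpow_two_mul_add {t : ℝ} (ht : 0 < t) (a : ℝ) : t ^ (2 * a + 1) = (t ^ 2) ^ a * t := by
  rw [Real.rpow_add ht, Real.rpow_mul ht.le, Real.rpow_one]
  norm_cast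

theorem integral_sq_substitution (α : ℝ) {a b t : ℝ} (ha : 0 < a) (hab : a ≤ b) (ht : 0 < t) :
    2 * t * ∫ z in (a ^ 2)..(b ^ 2), (t ^ 2) ^ α / z ^ (α + 1) =
      4 * ∫ m in Set.Icc a b, t ^ (2 * α + 1) / m ^ (2 * α + 1) := by
  have hpos : ∀ m ∈ Set.uIcc a b, 0 < m := fun m hm => by
    rw [Set.uIcc_of_le hab] at hm; exact ha.trans_le hm.1
  have h := intervalIntegral.integral_comp_mul_deriv' (a := a) (b := b) (f := fun m => m ^ 2)
    (f' := fun m => 2 * m) (g := fun z => (t ^ 2) ^ α / z ^ (α + 1))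
    (fun m _ => by simpa using hasDerivAt_pow 2 m) (by fun_prop) (by
      refine ContinuousOn.div continuousOn_const ?_ ?_
      · rintro _ ⟨m, hm, rfl⟩
        exact (Real.continuousAt_rpow_const _ _
          (Or.inl (pow_pos (hpos m hm) 2).ne')).continuousWithinAt
      · rintro _ ⟨m, hm, rfl⟩
        exact (Real.rpow_pos_of_pos (pow_pos (hpos m hm) 2) _).ne')
  rw [← h, integral_Icc_eq_integral_Ioc, ← intervalIntegral.integral_of_le hab,
    ← intervalIntegral.integral_const_mul, ← intervalIntegral.integral_const_mul]
  refine intervalIntegral.integral_congr fun m hm => ?_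
  have hm0 := hpos m hm
  have h1 : (0 : ℝ) < (m ^ 2) ^ α := Real.rpow_pos_of_pos (by positivity) _
  simp only [Function.comp]
  rw [rpow_two_mul_add ht, rpow_two_mul_add hm0, Real.rpow_add_one (by positivity)]
  field_simp
  ring

/-- The factor `∏ 2 y_k` is the Jacobian of squaring. On the left an empty box gives `0`, whereas
the oriented integral on the right would change sign; monotonicity of `y` and the indicators in
`kernelDensity` exclude exactly those cases. -/
theorem limitDensity_eq {α : ℝ} {N : ℕ} {x : Fin (N + 1) → ℝ} (hx0 : 0 ≤ x 0) (hx : StrictMono x)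
    {y : Fin N → ℝ} (hy : ∀ i, 0 < y i) :
    limitDensity α x y = (∏ k, 2 * y k) * {y : Fin N → ℝ | Monotone y}.indicator
      (kernelDensity α fun i => x i ^ 2) (fun i => y i ^ 2) := by
  have hx1 : ∀ i, 0 ≤ x i := fun i => hx0.trans (hx.monotone (Fin.zero_le i))
  have hsq : ∀ {a b : ℝ}, 0 ≤ a → 0 ≤ b → (a ^ 2 ≤ b ^ 2 ↔ a ≤ b) := fun ha hb =>
    pow_le_pow_iff_left₀ ha hb two_ne_zero
  have hmono : Monotone (fun i => y i ^ 2) ↔ Monotone y :=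
    forall₃_congr fun i j _ => hsq (hy i).le (hy j).le
  rw [limitDensity, integral_interlaces_eq_prod _ _ fun i => (hy i).le]
  have hempty : ∀ k, upperEnd x y k < max (x k.castSucc) (y k) →
      ∏ k, ∫ m in Set.Icc (max (x k.castSucc) (y k)) (upperEnd x y k),
        y k ^ (2 * α + 1) / m ^ (2 * α + 1) = 0 := fun k hk =>
    Finset.prod_eq_zero (Finset.mem_univ k) (by simp [Set.Icc_eq_empty hk.not_ge])
  by_cases hm : Monotone y
  swap
  · rw [Set.indicator_of_notMem (by simpa [hmono] using hm), mul_zero]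
    have : ∃ k j : Fin N, (k : ℕ) + 1 = j ∧ y j < y k := by
      by_contra! hcon
      refine hm ?_
      cases N with
      | zero => exact fun i => i.elim0
      | succ n => exact Fin.monotone_iff_le_succ.2 fun i => hcon _ _ (by simp)
    obtain ⟨k, j, hkj, hlt⟩ := this
    rw [hempty k (((upperEnd_le_of_eq x y hkj).trans_lt hlt).trans_le (le_max_right _ _)), mul_zero]
  rw [Set.indicator_of_mem (show _ from hmono.2 hm), kernelDensity]
  have hmin : ∀ k : Fin N, (if h : (k : ℕ) + 1 < N then min (x k.succ ^ 2) (y ⟨k + 1, h⟩ ^ 2)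
      else x k.succ ^ 2) = upperEnd x y k ^ 2 := fun k => by
    rw [upperEnd]; split_ifs with h
    · rcases le_total (x k.succ) (y ⟨k + 1, h⟩) with h1 | h1
      · rw [min_eq_left h1, min_eq_left ((hsq (hx1 _) (hy _).le).2 h1)]
      · rw [min_eq_right h1, min_eq_right ((hsq (hy _).le (hx1 _)).2 h1)]
    · rfl
  have hmax : ∀ k : Fin N, max (x k.castSucc ^ 2) (y k ^ 2) = max (x k.castSucc) (y k) ^ 2 :=
    fun k => by
      rcases le_total (x k.castSucc) (y k) with h1 | h1
      · rw [max_eq_right h1, max_eq_right ((hsq (hx1 _) (hy _).le).2 h1)]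
      · rw [max_eq_left h1, max_eq_left ((hsq (hy _).le (hx1 _)).2 h1)]
  simp only [hmin]
  suffices h : 2 ^ (2 * N) * ∏ k, ∫ m in Set.Icc (max (x k.castSucc) (y k)) (upperEnd x y k),
      y k ^ (2 * α + 1) / m ^ (2 * α + 1) = (∏ k, 2 * y k) * ∏ k : Fin N,
      (Set.Icc (if (k : ℕ) = 0 then 0 else x ⟨k - 1, by omega⟩ ^ 2) (x k.succ ^ 2)).indicator
        (fun t => ∫ z in (max (x k.castSucc ^ 2) t)..(upperEnd x y k ^ 2),
          t ^ α / z ^ (α + 1)) (y k ^ 2) by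
    linear_combination (N.factorial : ℝ) * shiftedFactorial (α + 1) N *
      (vdm (fun i => y i ^ 2) / vdm (fun i => x i ^ 2)) * h
  by_cases hc : ∀ k : Fin N, y k ^ 2 ∈
      Set.Icc (if (k : ℕ) = 0 then 0 else x ⟨k - 1, by omega⟩ ^ 2) (x k.succ ^ 2)
  · rw [pow_mul, ← Fin.prod_const, ← Finset.prod_mul_distrib, ← Finset.prod_mul_distrib]
    refine Finset.prod_congr rfl fun k _ => ?_
    rw [Set.indicator_of_mem (hc k), hmax, integral_sq_substitution α
      ((hy k).trans_le (le_max_right _ _)) _ (hy k)]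
    · norm_num
    have h1 : y k ≤ x k.succ := (hsq (hy k).le (hx1 _)).1 (hc k).2
    refine max_le ?_ ?_
    · rw [upperEnd]; split_ifs with h
      · refine le_min (hx (Fin.castSucc_lt_succ (i := k))).le ((hsq (hx1 _) (hy _).le).1 ?_)
        have h2 := (hc ⟨k + 1, h⟩).1
        rw [if_neg (by simp)] at h2
        exact h2
      · exact (hx (Fin.castSucc_lt_succ (i := k))).le
    · rw [upperEnd]; split_ifs with h
      · exact le_min h1 (hm (by simp [Fin.le_def]))
      · exact h1
  -- If `y_k` is too large, the `k`-th integration interval is empty; if it is too small, the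
  -- preceding one is, since `y_k` bounds that interval from above.
  · obtain ⟨k, hk⟩ := not_forall.1 hc
    refine Eq.trans ?_ (mul_eq_zero_of_right _ (Finset.prod_eq_zero (Finset.mem_univ k)
      (Set.indicator_of_notMem hk _))).symm
    by_cases h1 : y k ≤ x k.succ
    · by_cases hk0 : (k : ℕ) = 0
      · refine absurd ⟨?_, (hsq (hy k).le (hx1 _)).2 h1⟩ hk
        rw [if_pos hk0]; positivity
      · have h2 : y k < x ⟨k - 1, by omega⟩ := by
          by_contra! h2
          refine hk ⟨?_, (hsq (hy k).le (hx1 _)).2 h1⟩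
          rw [if_neg hk0]
          exact (hsq (hx1 _) (hy _).le).2 h2
        rw [hempty ⟨k - 1, by omega⟩ ?_, mul_zero]
        refine (upperEnd_le_of_eq x y (j := k) (by simp; omega)).trans_lt (h2.trans_le ?_)
        exact le_max_left _ _
    · rw [hempty k ((upperEnd_le x y k).trans_lt ((not_le.1 h1).trans_le (le_max_right _ _))),
        mul_zero]

theorem limitDensity_eq_zero {α : ℝ} {N : ℕ} {x : Fin (N + 1) → ℝ} {y : Fin N → ℝ}
    (h : ¬ ∀ i, 0 ≤ y i) : limitDensity α x y = 0 := by
  have : ∀ mu : Fin N → ℝ, ¬ InterlacesZero mu y := fun mu hmu => h hmu.1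
  simp [limitDensity, this]

theorem lintegral_sq_substitution {N : ℕ} (g : (Fin N → ℝ) → ENNReal) :
    ∫⁻ y in {y : Fin N → ℝ | ∀ i, 0 < y i}, g y =
      ∫⁻ y in {y : Fin N → ℝ | ∀ i, 0 < y i},
        ENNReal.ofReal (∏ i, 2 * y i) * g (fun i => y i ^ 2) := by
  have hS : MeasurableSet {y : Fin N → ℝ | ∀ i, 0 < y i} := by measurability
  have himg : (fun (y : Fin N → ℝ) i => y i ^ 2) '' {y : Fin N → ℝ | ∀ i, 0 < y i} =
      {y : Fin N → ℝ | ∀ i, 0 < y i} := by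
    ext y
    refine ⟨?_, fun h => ⟨fun i => √(y i), fun i => Real.sqrt_pos.2 (h i),
      funext fun i => Real.sq_sqrt (h i).le⟩⟩
    rintro ⟨z, hz, rfl⟩ i
    exact pow_pos (hz i) 2
  have h := lintegral_image_eq_lintegral_abs_det_fderiv_mul (volume : Measure (Fin N → ℝ)) hS
    (f := fun y i => y i ^ 2)
    (f' := fun y => (Matrix.toLin' (Matrix.diagonal fun i => 2 * y i)).toContinuousLinearMap)
    (fun y _ => by
      refine HasFDerivAt.hasFDerivWithinAt (hasFDerivAt_pi'' fun i => ?_)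
      have h1 := ((hasFDerivAt_apply (𝕜 := ℝ) i y).pow 2)
      refine h1.congr_fderiv ?_
      ext v
      simp [Matrix.mulVec_diagonal])
    (fun y hy z hz hyz => funext fun i =>
      (pow_left_inj₀ (hy i).le (hz i).le two_ne_zero).1 (congrFun hyz i)) g
  rw [himg] at h
  rw [h]
  refine setLIntegral_congr_fun hS fun y hy => ?_
  have h2 : 0 ≤ ∏ i, 2 * y i := Finset.prod_nonneg fun i _ => by have := hy i; linarith
  have h3 : ((Matrix.toLin' (Matrix.diagonal fun i => 2 * y i)).toContinuousLinearMap).det =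
      ∏ i, 2 * y i := by
    rw [ContinuousLinearMap.det, LinearMap.coe_toContinuousLinearMap, LinearMap.det_toLin',
      Matrix.det_diagonal]
  simp only [h3, abs_of_nonneg h2]

theorem ae_forall_ne_zero (N : ℕ) : ∀ᵐ y : Fin N → ℝ, ∀ i, y i ≠ 0 :=
  ae_all_iff.2 fun i => by
    rw [volume_pi, ae_iff]
    simpa using Measure.pi_hyperplane (fun _ : Fin N => (volume : Measure ℝ)) i 0

theorem map_sq_limitMeasure {α : ℝ} {N : ℕ} {x : Fin (N + 1) → ℝ} (hx0 : 0 ≤ x 0)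
    (hx : StrictMono x) :
    (limitMeasure α x).map (fun nu i => nu i ^ 2) = lambdaKernel α (fun i => x i ^ 2) := by
  classical
  have hsq : Measurable fun (nu : Fin N → ℝ) i => nu i ^ 2 := by fun_prop
  have hS : MeasurableSet {y : Fin N → ℝ | ∀ i, 0 < y i} := by measurability
  have hM : MeasurableSet {y : Fin N → ℝ | Monotone y} := by
    have : {y : Fin N → ℝ | Monotone y} = ⋂ (i : Fin N) (j : Fin N) (_ : i ≤ j),
        {y | y i ≤ y j} := by ext y; simp [Monotone]
    rw [this]
    exact MeasurableSet.iInter fun i => MeasurableSet.iInter fun j => MeasurableSet.iInter fun _ =>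
      measurableSet_le (measurable_pi_apply i) (measurable_pi_apply j)
  have hOM : MeasurableSet {y : Fin N → ℝ | (∀ i, 0 ≤ y i) ∧ Monotone y} := by
    refine MeasurableSet.inter ?_ hM
    exact measurableSet_setOfPred.2 (by measurability)
  ext A hA
  rw [Measure.map_apply hsq hA, limitMeasure, withDensity_apply _ (hsq hA), lambdaKernel,
    withDensity_apply _ hA, Measure.restrict_restrict hA, ← lintegral_indicator (hsq hA),
    ← lintegral_indicator (hA.inter hOM)]
  -- Both sides are compared on the open orthant, where squaring is injective; the coordinate
  -- hyperplanes are null.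
  trans ∫⁻ y in {y : Fin N → ℝ | ∀ i, 0 < y i}, (A ∩ {y | Monotone y}).indicator
    (fun y => ENNReal.ofReal (kernelDensity α (fun i => x i ^ 2) y)) y
  · rw [lintegral_sq_substitution, ← lintegral_indicator hS]
    refine lintegral_congr_ae ?_
    filter_upwards [ae_forall_ne_zero N] with y hy
    by_cases hyS : ∀ i, 0 < y i
    · rw [Set.indicator_of_mem (show y ∈ {y : Fin N → ℝ | ∀ i, 0 < y i} from hyS)]
      have h2 : 0 ≤ ∏ i, 2 * y i := Finset.prod_nonneg fun i _ => by have := hyS i; linarith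
      simp only [Set.indicator_apply, Set.mem_preimage, limitDensity_eq hx0 hx hyS,
        ENNReal.ofReal_mul h2, Set.mem_inter_iff]
      split_ifs <;> simp_all
    · rw [Set.indicator_of_notMem (show y ∉ {y : Fin N → ℝ | ∀ i, 0 < y i} from hyS)]
      have h3 : ¬ ∀ i, 0 ≤ y i := fun h => hyS fun i => lt_of_le_of_ne (h i) (hy i).symm
      simp [Set.indicator_apply, limitDensity_eq_zero h3]
  · rw [← lintegral_indicator hS]
    refine lintegral_congr_ae ?_
    filter_upwards [ae_forall_ne_zero N] with y hy
    have h3 : (∀ i, 0 ≤ y i) ↔ ∀ i, 0 < y i :=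
      forall_congr' fun i => ⟨fun h => lt_of_le_of_ne h (hy i).symm, le_of_lt⟩
    simp only [Set.indicator_apply, Set.mem_inter_iff, Set.mem_ofPred_eq, h3]
    split_ifs <;> simp_all

/-! ### Continuous interlacing integrals and the mass of the limit -/

theorem integrable_det {N : ℕ} {F : Fin N → Fin N → ℝ → ℝ} (hF : ∀ i j, Integrable (F i j)) :
    Integrable fun x : Fin N → ℝ => (Matrix.of fun i j => F i j (x i)).det := by
  simp_rw [← Matrix.det_transpose (Matrix.of _), Matrix.det_apply', Matrix.transpose_apply,
    Matrix.of_apply]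
  exact integrable_finsetSum _ fun σ _ =>
    (Integrable.fintype_prod fun i => hF i (σ i)).const_mul _

theorem integral_det {N : ℕ} {F : Fin N → Fin N → ℝ → ℝ} (hF : ∀ i j, Integrable (F i j)) :
    ∫ x : Fin N → ℝ, (Matrix.of fun i j => F i j (x i)).det =
      (Matrix.of fun i j => ∫ t, F i j t).det := by
  simp_rw [← Matrix.det_transpose (Matrix.of _), Matrix.det_apply', Matrix.transpose_apply,
    Matrix.of_apply]
  rw [integral_finsetSum _ fun σ _ =>
    (Integrable.fintype_prod fun i => hF i (σ i)).const_mul _]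
  refine Finset.sum_congr rfl fun σ _ => ?_
  rw [integral_const_mul, volume_pi, integral_fintype_prod_eq_prod fun i => F i (σ i)]

section box
variable {N : ℕ} {x : Fin (N + 1) → ℝ} {f F : Fin N → ℝ → ℝ}

open scoped Classical in
theorem det_box_eq (x : Fin (N + 1) → ℝ) (f : Fin N → ℝ → ℝ) (y : Fin N → ℝ) :
    (if Interlaces x y then (Matrix.of fun i j => f j (y i)).det else 0) =
      (Matrix.of fun i j =>
        (Set.Icc (x i.castSucc) (x i.succ)).indicator (f j) (y i)).det := by
  split_ifs with h
  · congr 1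
    ext i j
    rw [Matrix.of_apply, Matrix.of_apply,
      Set.indicator_of_mem (show y i ∈ Set.Icc (x i.castSucc) (x i.succ) from h i)]
  · obtain ⟨i, hi⟩ := not_forall.1 h
    exact (Matrix.det_eq_zero_of_row_eq_zero i fun j => Set.indicator_of_notMem
      (show y i ∉ Set.Icc (x i.castSucc) (x i.succ) from hi) _).symm

open scoped Classical in
theorem integrable_box_det
    (hf : ∀ i j, IntegrableOn (f j) (Set.Icc (x (Fin.castSucc i)) (x i.succ))) :
    Integrable fun y : Fin N → ℝ =>
      if Interlaces x y then (Matrix.of fun i j => f j (y i)).det else 0 := by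
  simp_rw [det_box_eq]
  exact integrable_det fun i j => (hf i j).integrable_indicator measurableSet_Icc

open scoped Classical in
theorem integral_box_det
    (hf : ∀ i j, IntegrableOn (f j) (Set.Icc (x (Fin.castSucc i)) (x i.succ)))
    (hF : ∀ i j, ∫ t in Set.Icc (x (Fin.castSucc i)) (x i.succ), f j t =
      F j (x i.succ) - F j (x i.castSucc)) :
    ∫ y : Fin N → ℝ, (if Interlaces x y then (Matrix.of fun i j => f j (y i)).det else 0) =
      (Matrix.of fun i : Fin (N + 1) =>
        (Fin.cons 1 fun j => F j (x i) : Fin (N + 1) → ℝ)).det := by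
  simp_rw [det_box_eq]
  rw [integral_det fun i j => (hf i j).integrable_indicator measurableSet_Icc, det_cons_one]
  congr 1
  ext i j
  rw [Matrix.of_apply, Matrix.of_apply, integral_indicator measurableSet_Icc, hF]

end box

theorem det_pow_sq {n : ℕ} (x : Fin n → ℝ) :
    (Matrix.of fun i j : Fin n => (x i ^ 2) ^ (j : ℕ)).det = vdm fun i => x i ^ 2 :=
  Matrix.det_vandermonde _

theorem integrableOn_sq_pow_mul_rpow {α : ℝ} (hα : -1 < α) (j : ℕ) {a b : ℝ}
    (hab : a ≤ b) :
    IntegrableOn (fun t : ℝ => (t ^ 2) ^ j * t ^ (2 * α + 1)) (Set.Icc a b) := by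
  have h := (intervalIntegral.intervalIntegrable_rpow' (a := a) (b := b)
    (show -1 < 2 * α + 1 by linarith)).continuousOn_mul
    (g := fun t => (t ^ 2) ^ j) (by fun_prop)
  rwa [intervalIntegrable_iff_integrableOn_Icc_of_le hab] at h

theorem integral_sq_pow_mul_rpow {α : ℝ} (hα : -1 < α) (j : ℕ) {a b : ℝ} (ha : 0 ≤ a)
    (hab : a ≤ b) :
    ∫ t in Set.Icc a b, (t ^ 2) ^ j * t ^ (2 * α + 1) =
      (2 * (α + 1 + j))⁻¹ * b ^ (2 * (α + 1 + j)) - (2 * (α + 1 + j))⁻¹ * a ^ (2 * (α + 1 + j)) := by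
  have hj : (0 : ℝ) ≤ j := j.cast_nonneg
  -- Dropping the left end point ensures `t > 0`, so the real powers combine even when `a = 0`.
  have h1 : ∫ t in Set.Ioc a b, (t ^ 2) ^ j * t ^ (2 * α + 1) =
      ∫ t in Set.Ioc a b, t ^ (2 * (α + j) + 1) :=
    setIntegral_congr_fun measurableSet_Ioc fun t ht => by
      have ht0 : 0 < t := ha.trans_lt ht.1
      rw [← pow_mul, ← Real.rpow_natCast, ← Real.rpow_add ht0]
      congr 1; push_cast; ring
  rw [integral_Icc_eq_integral_Ioc, h1, ← intervalIntegral.integral_of_le hab,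
    integral_rpow (Or.inl (by linarith)),
    show 2 * (α + j) + 1 + 1 = 2 * (α + 1 + j) by ring]
  ring

theorem integral_odd_pow (j : ℕ) {a b : ℝ} (hab : a ≤ b) :
    ∫ t in Set.Icc a b, (t ^ 2) ^ j * t =
      (2 * ((j : ℝ) + 1))⁻¹ * (b ^ 2) ^ (j + 1) - (2 * ((j : ℝ) + 1))⁻¹ * (a ^ 2) ^ (j + 1) := by
  have h1 : ∀ t : ℝ, (t ^ 2) ^ j * t = t ^ (2 * j + 1) := fun t => by ring
  simp_rw [h1]
  rw [integral_Icc_eq_integral_Ioc, ← intervalIntegral.integral_of_le hab, integral_pow]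
  push_cast
  rw [← pow_mul, ← pow_mul, mul_add, mul_one, ← mul_sub, inv_mul_eq_div,
    show 2 * j + 1 + 1 = 2 * (j + 1) by ring]
  congr 1; ring

section inner
variable {α : ℝ} (hα : -1 < α) {N : ℕ}

theorem monotone_cons_zero {mu : Fin N → ℝ} (hmu : Monotone mu) (h0 : ∀ i, 0 ≤ mu i) :
    Monotone (Fin.cons 0 mu : Fin (N + 1) → ℝ) := by
  intro i j hij
  refine Fin.cases (fun _ => ?_) (fun i => ?_) i hij
  · exact Fin.cases le_rfl h0 j
  · refine Fin.cases (fun h => absurd h (by simp)) (fun j h => ?_) j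
    simpa using hmu (by simpa using h)

include hα

-- Continuous counterpart of `sum_vdm_mul_branchA`: the antiderivatives `t^{2(α+1+j)}` vanish at the
-- extra node `0` because `α > -1`.
open scoped Classical in
theorem inner_integral {mu : Fin N → ℝ} (hmu : Monotone mu) (h0 : ∀ i, 0 < mu i) :
    Integrable (fun nu : Fin N → ℝ => if InterlacesZero mu nu then
      (Matrix.of fun i j : Fin N => (nu i ^ 2) ^ (j : ℕ) * nu i ^ (2 * α + 1)).det else 0) ∧
    ∫ nu : Fin N → ℝ, (if InterlacesZero mu nu then
      (Matrix.of fun i j : Fin N => (nu i ^ 2) ^ (j : ℕ) * nu i ^ (2 * α + 1)).det else 0) =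
    (2 ^ N * shiftedFactorial (α + 1) N)⁻¹ * ((∏ i, mu i ^ (2 * α + 1)) *
      (Matrix.of fun i j : Fin N => (mu i ^ 2) ^ (j : ℕ) * mu i).det) := by
  have hm := monotone_cons_zero hmu fun i => (h0 i).le
  have hc0 : ∀ i, 0 ≤ (Fin.cons 0 mu : Fin (N + 1) → ℝ) i := fun i =>
    Fin.cases le_rfl (fun i => (h0 i).le) i
  have hab : ∀ i : Fin N, (Fin.cons 0 mu : Fin (N + 1) → ℝ) i.castSucc ≤
      (Fin.cons 0 mu : Fin (N + 1) → ℝ) i.succ := fun i => hm (Fin.castSucc_lt_succ (i := i)).le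
  simp_rw [interlacesZero_iff fun i => (h0 i).le]
  refine ⟨integrable_box_det (f := fun (j : Fin N) t => (t ^ 2) ^ (j : ℕ) * t ^ (2 * α + 1))
    fun i j => integrableOn_sq_pow_mul_rpow hα j (hab i), ?_⟩
  rw [integral_box_det (f := fun (j : Fin N) t => (t ^ 2) ^ (j : ℕ) * t ^ (2 * α + 1))
    (fun i j => integrableOn_sq_pow_mul_rpow hα j (hab i))
    (F := fun j t => (2 * (α + 1 + (j : ℕ)))⁻¹ * t ^ (2 * (α + 1 + (j : ℕ))))
    (fun i j => integral_sq_pow_mul_rpow hα j (hc0 _) (hab i)), det_cons_one_zero,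
    ← prod_two_mul_add_inv, ← Matrix.det_mul_column, ← Matrix.det_mul_row]
  · congr 1
    ext i j
    simp only [Matrix.of_apply, Fin.cons_succ]
    have e : mu i ^ (2 * (α + 1 + (j : ℕ))) = mu i ^ (2 * α + 1) * ((mu i ^ 2) ^ (j : ℕ) * mu i) := by
      rw [show (mu i ^ 2) ^ (j : ℕ) * mu i = mu i ^ (2 * (j : ℕ) + 1) by ring, ← Real.rpow_natCast,
        ← Real.rpow_add (h0 i)]
      congr 1; push_cast; ring
    rw [e]
  · intro j
    have hj : (0 : ℝ) ≤ (j : ℕ) := (j : ℕ).cast_nonneg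
    rw [Fin.cons_zero, Real.zero_rpow (by linarith), mul_zero]

end inner

open scoped Classical in
theorem outer_integral {N : ℕ} {lam : Fin (N + 1) → ℝ} (hlam : Monotone lam) :
    Integrable (fun mu : Fin N → ℝ => if Interlaces lam mu then
      (Matrix.of fun i j : Fin N => (mu i ^ 2) ^ (j : ℕ) * mu i).det else 0) ∧
    ∫ mu : Fin N → ℝ, (if Interlaces lam mu then
      (Matrix.of fun i j : Fin N => (mu i ^ 2) ^ (j : ℕ) * mu i).det else 0) =
    (2 ^ N * (N.factorial : ℝ))⁻¹ * vdm fun i => lam i ^ 2 := by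
  have hab : ∀ i : Fin N, lam i.castSucc ≤ lam i.succ := fun i =>
    hlam (Fin.castSucc_lt_succ (i := i)).le
  have hint : ∀ i j : Fin N, IntegrableOn (fun t : ℝ => (t ^ 2) ^ (j : ℕ) * t)
      (Set.Icc (lam i.castSucc) (lam i.succ)) := fun i j =>
    (Continuous.continuousOn (by fun_prop)).integrableOn_Icc
  refine ⟨integrable_box_det (f := fun (j : Fin N) t => (t ^ 2) ^ (j : ℕ) * t) hint, ?_⟩
  rw [integral_box_det (f := fun (j : Fin N) t => (t ^ 2) ^ (j : ℕ) * t) hint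
    (F := fun j t => (2 * (((j : ℕ) : ℝ) + 1))⁻¹ * (t ^ 2) ^ ((j : ℕ) + 1))
    fun i j => integral_odd_pow j (hab i)]
  have h3 : (2 ^ N * (N.factorial : ℝ))⁻¹ = ∏ j : Fin (N + 1),
      (Fin.cons 1 (fun j : Fin N => (2 * ((j : ℝ) + 1))⁻¹) : Fin (N + 1) → ℝ) j := by
    rw [Fin.prod_univ_succ]
    simp only [Fin.cons_zero, Fin.cons_succ, one_mul, Finset.prod_inv_distrib,
      Finset.prod_mul_distrib]
    rw [← Finset.prod_range_add_one_eq_factorial, Finset.prod_range]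
    simp
  rw [← det_pow_sq, h3, ← Matrix.det_mul_row]
  congr 1
  ext i j
  refine Fin.cases ?_ (fun j => ?_) j
  · simp
  · simp

open scoped Classical in
/-- The density of the limit of `(μ, ν)`, before integrating out `μ`. -/
noncomputable def jointDensity (α : ℝ) {N : ℕ} (lam : Fin (N + 1) → ℝ)
    (p : (Fin N → ℝ) × (Fin N → ℝ)) : ℝ :=
  if Interlaces lam p.1 ∧ InterlacesZero p.1 p.2 then
    2 ^ (2 * N) * (N.factorial : ℝ) * shiftedFactorial (α + 1) N *
      (vdm (fun i => p.2 i ^ 2) / vdm (fun i => lam i ^ 2)) *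
        ∏ k, p.2 k ^ (2 * α + 1) / p.1 k ^ (2 * α + 1)
  else 0

theorem integral_jointDensity (α : ℝ) {N : ℕ} (lam : Fin (N + 1) → ℝ) (nu : Fin N → ℝ) :
    ∫ mu, jointDensity α lam (mu, nu) = limitDensity α lam nu := by
  classical
  rw [limitDensity, ← integral_const_mul, ← integral_indicator (measurableSet_interlaces lam)]
  congr 1
  ext mu
  simp only [jointDensity, Set.indicator_apply, Set.mem_ofPred_eq, ite_and, mul_ite, mul_zero]

theorem measurable_jointDensity (α : ℝ) {N : ℕ} (lam : Fin (N + 1) → ℝ) :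
    Measurable (jointDensity α lam) := by
  have h1 : ∀ i, Measurable fun p : (Fin N → ℝ) × (Fin N → ℝ) => p.1 i := fun i => by fun_prop
  have h2 : ∀ i, Measurable fun p : (Fin N → ℝ) × (Fin N → ℝ) => p.2 i := fun i => by fun_prop
  refine Measurable.ite ?_ ?_ measurable_const
  · refine measurableSet_setOfPred.2 ?_
    refine Measurable.and ?_ (Measurable.and ?_ (Measurable.and ?_ ?_))
    · exact Measurable.forall fun i => Measurable.and
        (measurableSet_setOfPred.1 (measurableSet_le measurable_const (h1 i)))
        (measurableSet_setOfPred.1 (measurableSet_le (h1 i) measurable_const))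
    · exact Measurable.forall fun i =>
        measurableSet_setOfPred.1 (measurableSet_le measurable_const (h2 i))
    · exact Measurable.forall fun i =>
        measurableSet_setOfPred.1 (measurableSet_le (h2 i) (h1 i))
    · exact Measurable.forall fun i => Measurable.forall fun j => Measurable.imp measurable_const
        (measurableSet_setOfPred.1 (measurableSet_le (h1 i) (h2 j)))
  · refine Measurable.mul (Measurable.mul measurable_const (Measurable.div ?_ measurable_const)) ?_
    · unfold vdm; fun_prop
    · fun_prop

section joint
variable {α : ℝ} (hα : -1 < α) {N : ℕ} {lam : Fin (N + 1) → ℝ} (h0 : 0 ≤ lam 0)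
  (hlam : StrictMono lam)
include hα h0 hlam

omit hα in
theorem vdm_sq_pos : 0 < vdm fun i => lam i ^ 2 :=
  vdm_pos fun i _ hij => pow_lt_pow_left₀ (hlam hij) (h0.trans (hlam.monotone (Fin.zero_le i)))
    two_ne_zero

theorem jointDensity_nonneg (p : (Fin N → ℝ) × (Fin N → ℝ)) : 0 ≤ jointDensity α lam p := by
  unfold jointDensity
  split_ifs with h
  · have h1 := shiftedFactorial_pos hα N
    have h2 := vdm_sq_pos h0 hlam
    have h3 : 0 ≤ vdm fun i => p.2 i ^ 2 :=
      vdm_nonneg fun i _ hij => pow_le_pow_left₀ (h.2.1 i) (h.2.monotone hij) 2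
    have h4 : 0 ≤ ∏ k, p.2 k ^ (2 * α + 1) / p.1 k ^ (2 * α + 1) :=
      Finset.prod_nonneg fun k _ => div_nonneg (Real.rpow_nonneg (h.2.1 k) _)
        (Real.rpow_nonneg ((h.2.1 k).trans (h.2.2.1 k)) _)
    positivity
  · exact le_rfl

-- The inner integral returns `∏ μ_i^{2α+1}`, which cancels the denominators of the density and
-- leaves the integrand of `outer_integral`.
open scoped Classical in
theorem lintegral_jointDensity_right {mu : Fin N → ℝ} (hmu : ∀ i, mu i ≠ 0) :
    ∫⁻ nu, ENNReal.ofReal (jointDensity α lam (mu, nu)) =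
      ENNReal.ofReal (2 ^ N * (N.factorial : ℝ) * (vdm fun i => lam i ^ 2)⁻¹ *
        if Interlaces lam mu then
          (Matrix.of fun i j : Fin N => (mu i ^ 2) ^ (j : ℕ) * mu i).det else 0) := by
  by_cases hI : Interlaces lam mu
  swap
  · simp [jointDensity, hI]
  have hpos : ∀ i, 0 < mu i := fun i => lt_of_le_of_ne
    ((h0.trans (hlam.monotone (Fin.zero_le _))).trans (hI i).1) (hmu i).symm
  obtain ⟨hi, he⟩ := inner_integral hα hI.monotone hpos
  have hprod : ∏ i, mu i ^ (2 * α + 1) ≠ 0 :=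
    (Finset.prod_pos fun i _ => Real.rpow_pos_of_pos (hpos i) _).ne'
  have hsf := (shiftedFactorial_pos hα N).ne'
  have h1 : ∀ nu, jointDensity α lam (mu, nu) =
      2 ^ (2 * N) * (N.factorial : ℝ) * shiftedFactorial (α + 1) N *
        (vdm fun i => lam i ^ 2)⁻¹ * (∏ i, mu i ^ (2 * α + 1))⁻¹ *
      if InterlacesZero mu nu then
        (Matrix.of fun i j : Fin N => (nu i ^ 2) ^ (j : ℕ) * nu i ^ (2 * α + 1)).det else 0 := by
    intro nu
    have h2 := Matrix.det_mul_column (fun i : Fin N => nu i ^ (2 * α + 1))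
      (Matrix.of fun i j : Fin N => (nu i ^ 2) ^ (j : ℕ))
    simp only [Matrix.of_apply, mul_comm (_ ^ (2 * α + 1))] at h2
    simp only [jointDensity, hI, true_and]
    split_ifs
    · rw [h2, det_pow_sq, Finset.prod_div_distrib]
      ring
    · rw [mul_zero]
  rw [← ofReal_integral_eq_lintegral_ofReal]
  · simp_rw [h1]
    rw [integral_const_mul, he, if_pos hI]
    congr 1
    generalize ∏ i, mu i ^ (2 * α + 1) = P at hprod ⊢
    rw [pow_mul', sq]
    field_simp
  · simp_rw [h1]
    exact hi.const_mul _
  · exact ae_of_all _ fun nu => jointDensity_nonneg hα h0 hlam _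

/-- Computed directly, not obtained as a limit: Scheffé's argument needs mass one in the limit to
exclude an escape of mass. -/
theorem lintegral_jointDensity :
    ∫⁻ p, ENNReal.ofReal (jointDensity α lam p) = 1 := by
  classical
  rw [Measure.volume_eq_prod,
    lintegral_prod _ (measurable_jointDensity α lam).ennreal_ofReal.aemeasurable]
  have hv := vdm_sq_pos h0 hlam
  obtain ⟨hi, he⟩ := outer_integral hlam.monotone
  have hae : ∀ᵐ mu : Fin N → ℝ, ∫⁻ nu, ENNReal.ofReal (jointDensity α lam (mu, nu)) =
      ENNReal.ofReal (2 ^ N * (N.factorial : ℝ) * (vdm fun i => lam i ^ 2)⁻¹ *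
        if Interlaces lam mu then
          (Matrix.of fun i j : Fin N => (mu i ^ 2) ^ (j : ℕ) * mu i).det else 0) := by
    filter_upwards [ae_forall_ne_zero N] with mu hmu
    exact lintegral_jointDensity_right hα h0 hlam hmu
  rw [lintegral_congr_ae hae, ← ofReal_integral_eq_lintegral_ofReal (hi.const_mul _),
    integral_const_mul, he]
  · rw [← ENNReal.ofReal_one]
    congr 1
    field_simp
  · refine ae_of_all _ fun mu => mul_nonneg (by positivity) ?_
    split_ifs with hI
    · have hpos : ∀ i, 0 ≤ mu i := fun i => (h0.trans (hlam.monotone (Fin.zero_le _))).trans (hI i).1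
      have h2 := Matrix.det_mul_column (fun i : Fin N => mu i)
        (Matrix.of fun i j : Fin N => (mu i ^ 2) ^ (j : ℕ))
      simp only [Matrix.of_apply, mul_comm (mu _)] at h2
      rw [h2, det_pow_sq]
      exact mul_nonneg (Finset.prod_nonneg fun i _ => hpos i)
        (vdm_nonneg fun i _ hij => pow_le_pow_left₀ (hpos i) (hI.monotone hij) 2)
    · exact le_rfl

theorem integrable_jointDensity : Integrable (jointDensity α lam) := by
  refine ⟨(measurable_jointDensity α lam).aestronglyMeasurable, ?_⟩
  rw [hasFiniteIntegral_iff_ofReal (ae_of_all _ (jointDensity_nonneg hα h0 hlam)),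
    lintegral_jointDensity hα h0 hlam]
  exact ENNReal.one_lt_top

theorem limitMeasure_eq_map : limitMeasure α lam =
    ((volume : Measure ((Fin N → ℝ) × (Fin N → ℝ))).withDensity
      fun p => ENNReal.ofReal (jointDensity α lam p)).map Prod.snd := by
  ext A hA
  have hm := (measurable_jointDensity α lam).ennreal_ofReal
  rw [limitMeasure, withDensity_apply _ hA, Measure.map_apply measurable_snd hA,
    withDensity_apply _ (measurable_snd hA), ← Set.univ_prod, Measure.volume_eq_prod,
    ← Measure.prod_restrict, Measure.restrict_univ, lintegral_prod_symm _ hm.aemeasurable]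
  refine lintegral_congr_ae (ae_restrict_of_ae ?_)
  have hi := integrable_jointDensity hα h0 hlam
  rw [Measure.volume_eq_prod] at hi
  -- Integrability of almost every slice is needed because `limitDensity` is a Bochner integral,
  -- which would be `0` on a non-integrable slice.
  filter_upwards [hi.prod_left_ae] with nu hnu
  rw [← integral_jointDensity, ofReal_integral_eq_lintegral_ofReal hnu
    (ae_of_all _ fun mu => jointDensity_nonneg hα h0 hlam _)]

theorem isProbabilityMeasure_limitMeasure : IsProbabilityMeasure (limitMeasure α lam) := by
  constructor
  rw [limitMeasure_eq_map hα h0 hlam, Measure.map_apply measurable_snd MeasurableSet.univ,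
    Set.preimage_univ, withDensity_apply _ MeasurableSet.univ, Measure.restrict_univ,
    lintegral_jointDensity hα h0 hlam]

end joint

/-! ### Asymptotics of the weights -/

theorem Gamma_nat_add {a : ℝ} (ha : 0 < a) (n : ℕ) :
    Real.Gamma (n + a) = Real.Gamma a * ∏ j ∈ Finset.range n, (a + j) := by
  induction n with
  | zero => simp
  | succ n ih =>
    have hn : (0 : ℝ) ≤ n := n.cast_nonneg
    rw [Nat.cast_succ, add_right_comm, Real.Gamma_add_one (by linarith), ih,
      Finset.prod_range_succ]
    ring

/-- The quotient `Γ(n+a) / (n! n^{a-1})`, which tends to `1`. -/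
noncomputable def gammaRatio (a : ℝ) (n : ℕ) : ℝ :=
  Real.Gamma (n + a) / (n.factorial * (n : ℝ) ^ (a - 1))

theorem Gamma_eq_gammaRatio (a : ℝ) {n : ℕ} (hn : n ≠ 0) :
    Real.Gamma (n + a) = gammaRatio a n * (n.factorial * (n : ℝ) ^ (a - 1)) := by
  have h1 : (0 : ℝ) < n := by exact_mod_cast Nat.pos_of_ne_zero hn
  have h2 := Real.rpow_pos_of_pos h1 (a - 1)
  rw [gammaRatio, div_mul_cancel₀]
  positivity

theorem tendsto_const_div_natCast (c : ℝ) : Tendsto (fun n : ℕ => c / (n : ℝ)) atTop (𝓝 0) :=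
  tendsto_const_div_atTop_nhds_zero_nat c

/-- The ratio is `Γ(a)` divided by Euler's sequence for `Γ(a)`, times `n / (n + a)`. -/
theorem tendsto_gammaRatio {a : ℝ} (ha : 0 < a) : Tendsto (gammaRatio a) atTop (𝓝 1) := by
  have hG := (Real.Gamma_pos_of_pos ha).ne'
  have h1 : Tendsto (fun n : ℕ => Real.Gamma a / Real.GammaSeq a n * (1 + a / n)⁻¹) atTop
      (𝓝 (Real.Gamma a / Real.Gamma a * (1 + 0)⁻¹)) :=
    (tendsto_const_nhds.div (Real.GammaSeq_tendsto_Gamma a) hG).mul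
      ((tendsto_const_nhds.add (tendsto_const_div_natCast a)).inv₀ (by norm_num))
  rw [div_self hG, add_zero, inv_one, mul_one] at h1
  refine h1.congr' ?_
  filter_upwards [eventually_ne_atTop 0] with n hn
  have hn0 : (0 : ℝ) < n := by exact_mod_cast Nat.pos_of_ne_zero hn
  have hp : 0 < ∏ j ∈ Finset.range n, (a + (j : ℝ)) := Finset.prod_pos fun j _ => by positivity
  have hr := Real.rpow_pos_of_pos hn0 a
  rw [gammaRatio, Gamma_nat_add ha, Real.GammaSeq, Finset.prod_range_succ,
    Real.rpow_sub_one hn0.ne']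
  field_simp
  ring

section asymptotics
variable {α β : ℝ} (hα : -1 < α) (hβ : -1 < β)
include hα hβ

theorem tendsto_branchU :
    Tendsto (fun m : ℕ => branchU α β m * (m : ℝ) ^ (2 * α + 1)) atTop (𝓝 1) := by
  have h1 : Tendsto (fun m : ℕ => (1 + (α + β + 2) / 2 / m) * gammaRatio (β + 1) m *
      (gammaRatio (α + β + 2) m)⁻¹ * (gammaRatio (α + 2) m)⁻¹) atTop
      (𝓝 ((1 + 0) * 1 * 1⁻¹ * 1⁻¹)) :=
    (((tendsto_const_nhds.add (tendsto_const_div_natCast _)).mul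
      (tendsto_gammaRatio (by linarith))).mul
      ((tendsto_gammaRatio (by linarith)).inv₀ one_ne_zero)).mul
      ((tendsto_gammaRatio (by linarith)).inv₀ one_ne_zero)
  rw [add_zero, inv_one, mul_one, mul_one, mul_one] at h1
  refine h1.congr' ?_
  filter_upwards [eventually_ne_atTop 0] with m hm
  have hm0 : (0 : ℝ) < m := by exact_mod_cast Nat.pos_of_ne_zero hm
  rw [branchU, add_assoc (m : ℝ) β 1, add_assoc (m : ℝ) α β, add_assoc (m : ℝ) (α + β) 2,
    add_assoc (m : ℝ) α 2, Gamma_eq_gammaRatio _ hm, Gamma_eq_gammaRatio _ hm,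
    Gamma_eq_gammaRatio _ hm]
  have e : (m : ℝ) ^ (β + 1 - 1) * (m : ℝ) ^ (2 * α + 1) * m =
      (m : ℝ) ^ (α + β + 2 - 1) * (m : ℝ) ^ (α + 2 - 1) := by
    rw [← Real.rpow_add hm0, ← Real.rpow_add_one hm0.ne', ← Real.rpow_add hm0]
    congr 1; ring
  have r1 := Real.rpow_pos_of_pos hm0 (α + β + 2 - 1)
  have r2 := Real.rpow_pos_of_pos hm0 (α + 2 - 1)
  have e' : (m : ℝ) ^ (β + 1 - 1) * (m : ℝ) ^ (2 * α + 1) =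
      (m : ℝ) ^ (α + β + 2 - 1) * (m : ℝ) ^ (α + 2 - 1) / m := by
    rw [eq_div_iff hm0.ne', e]
  generalize (m : ℝ) ^ (α + β + 2 - 1) = x1 at *
  generalize (m : ℝ) ^ (α + 2 - 1) = x2 at *
  generalize (m : ℝ) ^ (β + 1 - 1) = x3 at *
  generalize (m : ℝ) ^ (2 * α + 1) = x4 at *
  have hf : (m.factorial : ℝ) ≠ 0 := by positivity
  symm
  calc _ = (x3 * x4) * ((2 * (m : ℝ) + α + β + 2) * (gammaRatio (β + 1) m * m.factorial) *
        m.factorial / (2 * (gammaRatio (α + β + 2) m * (m.factorial * x1)) *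
          (gammaRatio (α + 2) m * (m.factorial * x2)))) := by ring
    _ = _ := by
      rw [e']
      field_simp
      ring

theorem tendsto_branchV :
    Tendsto (fun l : ℕ => branchV α β l / (l : ℝ) ^ (2 * α + 1)) atTop (𝓝 2) := by
  have h1 : Tendsto (fun l : ℕ => (2 + (α + β + 1) / l) * (1 + (α + β + 1) / l)⁻¹ *
      gammaRatio (α + β + 2) l * gammaRatio (α + 1) l * (gammaRatio (β + 1) l)⁻¹) atTop
      (𝓝 ((2 + 0) * (1 + 0)⁻¹ * 1 * 1 * 1⁻¹)) :=
    ((((tendsto_const_nhds.add (tendsto_const_div_natCast _)).mul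
      ((tendsto_const_nhds.add (tendsto_const_div_natCast _)).inv₀ (by norm_num))).mul
      (tendsto_gammaRatio (by linarith))).mul
      (tendsto_gammaRatio (by linarith))).mul
      ((tendsto_gammaRatio (by linarith)).inv₀ one_ne_zero)
  rw [add_zero, add_zero, inv_one, mul_one, mul_one, mul_one, mul_one] at h1
  refine h1.congr' ?_
  filter_upwards [eventually_ne_atTop 0] with l hl
  have hl1 : (1 : ℝ) ≤ l := by exact_mod_cast Nat.one_le_iff_ne_zero.2 hl
  have hl0 : (0 : ℝ) < l := by linarith
  rw [branchV, branchWeight_eq hα hβ l hl, add_assoc (l : ℝ) β 1, add_assoc (l : ℝ) α β,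
    add_assoc (l : ℝ) (α + β) 2, add_assoc (l : ℝ) α 1, Gamma_eq_gammaRatio _ hl,
    Gamma_eq_gammaRatio _ hl, Gamma_eq_gammaRatio _ hl]
  have e : (l : ℝ) ^ (β + 1 - 1) * (l : ℝ) ^ (2 * α + 1) =
      (l : ℝ) ^ (α + β + 2 - 1) * (l : ℝ) ^ (α + 1 - 1) := by
    rw [← Real.rpow_add hl0, ← Real.rpow_add hl0]
    congr 1; ring
  have r3 := Real.rpow_pos_of_pos hl0 (β + 1 - 1)
  have r4 := Real.rpow_pos_of_pos hl0 (2 * α + 1)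
  generalize (l : ℝ) ^ (α + β + 2 - 1) = x1 at *
  generalize (l : ℝ) ^ (α + 1 - 1) = x2 at *
  generalize (l : ℝ) ^ (β + 1 - 1) = x3 at *
  generalize (l : ℝ) ^ (2 * α + 1) = x4 at *
  have hf : (l.factorial : ℝ) ≠ 0 := by positivity
  have q1 : (l : ℝ) + (α + β) + 1 ≠ 0 := by linarith
  have q2 : (l : ℝ) + (α + β + 1) ≠ 0 := by linarith
  symm
  calc _ = (x1 * x2) / (x3 * x4) * ((2 * (l : ℝ) + α + β + 1) / (l + (α + β) + 1) *
        gammaRatio (α + β + 2) l * gammaRatio (α + 1) l * (gammaRatio (β + 1) l)⁻¹ *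
          ((l.factorial / l.factorial) * (l.factorial / l.factorial) : ℝ)) := by ring
    _ = _ := by
      rw [← e, div_self (mul_pos r3 r4).ne', div_self hf]
      have e1 : (1 + (α + β + 1) / (l : ℝ)) = (l + (α + β) + 1) / l := by field_simp; ring
      have e2 : (2 + (α + β + 1) / (l : ℝ)) = (2 * l + α + β + 1) / l := by field_simp; ring
      rw [e1, e2]
      field_simp

end asymptotics

/-! ### Pointwise convergence of the rescaled weights -/

/-- The integer points `⌊κ x_i⌋`. -/
noncomputable def floorScale (κ : ℕ) {n : ℕ} (x : Fin n → ℝ) : Fin n → ℕ :=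
  fun i => ⌊(κ : ℝ) * x i⌋₊

theorem tendsto_floorScale_div {x : ℝ} (hx : 0 ≤ x) :
    Tendsto (fun κ : ℕ => (⌊(κ : ℝ) * x⌋₊ : ℝ) / κ) atTop (𝓝 x) := by
  have h := (tendsto_nat_floor_mul_div_atTop hx).comp (tendsto_natCast_atTop_atTop (R := ℝ))
  refine h.congr fun κ => ?_
  simp [mul_comm]

theorem tendsto_floorScale_add_div {x : ℝ} (hx : 0 ≤ x) (i : ℕ) :
    Tendsto (fun κ : ℕ => ((⌊(κ : ℝ) * x⌋₊ + i : ℕ) : ℝ) / κ) atTop (𝓝 x) := by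
  have h := (tendsto_floorScale_div hx).add (tendsto_const_div_natCast i)
  rw [add_zero] at h
  refine h.congr fun κ => ?_
  push_cast
  rw [add_div]

theorem tendsto_floorScale_add_atTop {x : ℝ} (hx : 0 < x) (i : ℕ) :
    Tendsto (fun κ : ℕ => ⌊(κ : ℝ) * x⌋₊ + i) atTop atTop :=
  tendsto_atTop_mono (fun _ => Nat.le_add_right _ _) (tendsto_nat_floor_atTop.comp
    ((tendsto_natCast_atTop_atTop (R := ℝ)).atTop_mul_const hx))

theorem tendsto_branchB {α β : ℝ} (hα : -1 < α) (hβ : -1 < β) {x y : ℝ} (hx : 0 < x) (hy : 0 < y)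
    (i : ℕ) :
    Tendsto (fun κ : ℕ => branchB α β (⌊(κ : ℝ) * x⌋₊ + i) (⌊(κ : ℝ) * y⌋₊ + i)) atTop
      (𝓝 (2 * (y ^ (2 * α + 1) / x ^ (2 * α + 1)))) := by
  have h1 := (tendsto_branchU hα hβ).comp (tendsto_floorScale_add_atTop hx i)
  have h2 := (tendsto_branchV hα hβ).comp (tendsto_floorScale_add_atTop hy i)
  have h3 := (tendsto_floorScale_add_div hx.le i).rpow_const (p := 2 * α + 1) (Or.inl hx.ne')
  have h4 := (tendsto_floorScale_add_div hy.le i).rpow_const (p := 2 * α + 1) (Or.inl hy.ne')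
  have h := (h1.mul h2).mul (h4.div h3 (Real.rpow_pos_of_pos hx _).ne')
  rw [one_mul] at h
  refine h.congr' ?_
  filter_upwards [eventually_ne_atTop 0,
    (tendsto_floorScale_add_atTop hx i).eventually_ne_atTop 0,
    (tendsto_floorScale_add_atTop hy i).eventually_ne_atTop 0] with κ hκ hm hl
  have hκ0 : (0 : ℝ) < κ := by exact_mod_cast Nat.pos_of_ne_zero hκ
  simp only [Function.comp, Pi.div_apply]
  generalize ⌊(κ : ℝ) * x⌋₊ + i = m at *
  generalize ⌊(κ : ℝ) * y⌋₊ + i = l at *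
  have hm0 : (0 : ℝ) < m := by exact_mod_cast Nat.pos_of_ne_zero hm
  have hl0 : (0 : ℝ) < l := by exact_mod_cast Nat.pos_of_ne_zero hl
  have p1 := Real.rpow_pos_of_pos hm0 (2 * α + 1)
  have p2 := Real.rpow_pos_of_pos hl0 (2 * α + 1)
  have p3 := Real.rpow_pos_of_pos hκ0 (2 * α + 1)
  rw [branchB_eq, Real.div_rpow hm0.le hκ0.le, Real.div_rpow hl0.le hκ0.le]
  generalize (m : ℝ) ^ (2 * α + 1) = x1 at *
  generalize (l : ℝ) ^ (2 * α + 1) = x2 at *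
  generalize (κ : ℝ) ^ (2 * α + 1) = x3 at *
  field_simp

theorem vdm_const_mul {n : ℕ} (c : ℝ) (x : Fin n → ℝ) :
    vdm (fun i => c * x i) = c ^ (∑ i : Fin n, (i : ℕ)) * vdm x := by
  have h1 : ∀ x : Fin n → ℝ, vdm x = (Matrix.vandermonde x).det := fun x =>
    (Matrix.det_vandermonde x).symm
  rw [h1, h1, ← Finset.prod_pow_eq_pow_sum, ← Matrix.det_mul_row]
  congr 1
  ext i j
  simp [Matrix.vandermonde_apply, mul_pow]

theorem tendsto_vdm_nodes (s : ℝ) {n : ℕ} {x : Fin n → ℝ} (hx : ∀ i, 0 ≤ x i) :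
    Tendsto (fun κ : ℕ => vdm fun i => ((κ : ℝ) ^ 2)⁻¹ * nodes s (floorScale κ x) i) atTop
      (𝓝 (vdm fun i => x i ^ 2)) := by
  have h : ∀ i, Tendsto (fun κ : ℕ => ((κ : ℝ) ^ 2)⁻¹ * nodes s (floorScale κ x) i) atTop
      (𝓝 (x i ^ 2)) := fun i => by
    have h1 := tendsto_floorScale_add_div (hx i) i
    have h2 := h1.mul (h1.add (tendsto_const_div_natCast s))
    rw [add_zero, ← sq] at h2
    refine h2.congr fun κ => ?_
    simp only [nodes, quadNode, floorScale]
    rw [← add_div, div_mul_div_comm, div_eq_inv_mul, sq]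
  exact tendsto_finsetProd _ fun i _ => tendsto_finsetProd _ fun j _ => (h j).sub (h i)

/-- If `b < a`, the gap `κ (a - b)` eventually reaches 1 and separates the floors; `0 ≤ b` keeps the
truncation of the natural floor at `0` from hiding it. -/
theorem eventually_floor_le_iff {a b : ℝ} (hb : 0 ≤ b) (hab : a ≠ b) :
    ∀ᶠ κ : ℕ in atTop, (⌊(κ : ℝ) * a⌋₊ ≤ ⌊(κ : ℝ) * b⌋₊ ↔ a ≤ b) := by
  rcases hab.lt_or_gt with h | h
  · exact Eventually.of_forall fun κ => iff_of_true
      (Nat.floor_le_floor (mul_le_mul_of_nonneg_left h.le κ.cast_nonneg)) h.le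
  · filter_upwards [((tendsto_natCast_atTop_atTop (R := ℝ)).atTop_mul_const
      (sub_pos.2 h)).eventually_ge_atTop 1] with κ hκ
    refine iff_of_false (fun hle => ?_) h.not_ge
    have h1 := Nat.lt_floor_add_one ((κ : ℝ) * b)
    have h2 : ⌊(κ : ℝ) * b⌋₊ + 1 ≤ ⌊(κ : ℝ) * a⌋₊ := by
      refine Nat.le_floor ?_
      have := Nat.floor_le (show 0 ≤ (κ : ℝ) * b by positivity)
      push_cast
      linarith
    omega

theorem floorScale_natCast (κ : ℕ) {n : ℕ} (lam : Fin n → ℕ) :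
    floorScale κ (fun i => (lam i : ℝ)) = fun i => κ * lam i :=
  funext fun i => by rw [floorScale]; exact_mod_cast Nat.floor_natCast (κ * lam i)

open scoped Classical in
/-- The summand of the discrete kernel. -/
noncomputable def discreteWeight (α β : ℝ) {N : ℕ} (lam : Fin (N + 1) → ℕ) (mu nu : Fin N → ℕ) :
    ℝ :=
  if Interlaces lam mu ∧ InterlacesZero mu nu then
    2 ^ N * (shiftedFactorial (α + 1) N * (N.factorial : ℝ)) *
      (vdm (nodes (α + β + 1) nu) / vdm (nodes (α + β + 1) lam)) * branchA α β mu nu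
  else 0

/-- The rescaled step density on `ℝ^N × ℝ^N`. -/
noncomputable def stepDensity (α β : ℝ) {N : ℕ} (lam : Fin (N + 1) → ℝ) (κ : ℕ)
    (p : (Fin N → ℝ) × (Fin N → ℝ)) : ℝ :=
  ((κ : ℝ) ^ 2) ^ N *
    discreteWeight α β (floorScale κ lam) (floorScale κ p.1) (floorScale κ p.2)

theorem tendsto_stepDensity {α β : ℝ} (hα : -1 < α) (hβ : -1 < β) {N : ℕ} {lam : Fin (N + 1) → ℝ}
    (h0 : 0 ≤ lam 0) (hlam : StrictMono lam) {p : (Fin N → ℝ) × (Fin N → ℝ)}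
    (h1 : ∀ i, 0 < p.1 i) (h2 : ∀ i, 0 < p.2 i) (h3 : ∀ i j, p.1 i ≠ lam j)
    (h4 : ∀ i j, p.1 i ≠ p.2 j) :
    Tendsto (fun κ => stepDensity α β lam κ p) atTop (𝓝 (jointDensity α lam p)) := by
  have hl0 : ∀ i, 0 ≤ lam i := fun i => h0.trans (hlam.monotone (Fin.zero_le i))
  -- At a point avoiding all relevant equalities, the discrete and continuous interlacing conditions
  -- eventually agree.
  have hev : ∀ᶠ κ : ℕ in atTop, ((Interlaces (floorScale κ lam) (floorScale κ p.1) ∧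
      InterlacesZero (floorScale κ p.1) (floorScale κ p.2)) ↔
      (Interlaces lam p.1 ∧ InterlacesZero p.1 p.2)) := by
    have e1 : ∀ᶠ κ : ℕ in atTop, ∀ i : Fin N, (floorScale κ lam i.castSucc ≤ floorScale κ p.1 i ↔
        lam i.castSucc ≤ p.1 i) :=
      eventually_all.2 fun i => eventually_floor_le_iff (h1 _).le (h3 _ _).symm
    have e2 : ∀ᶠ κ : ℕ in atTop, ∀ i : Fin N, (floorScale κ p.1 i ≤ floorScale κ lam i.succ ↔
        p.1 i ≤ lam i.succ) :=
      eventually_all.2 fun i => eventually_floor_le_iff (hl0 _) (h3 _ _)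
    have e3 : ∀ᶠ κ : ℕ in atTop, ∀ i : Fin N, (floorScale κ p.2 i ≤ floorScale κ p.1 i ↔
        p.2 i ≤ p.1 i) :=
      eventually_all.2 fun i => eventually_floor_le_iff (h1 _).le (h4 _ _).symm
    have e4 : ∀ᶠ κ : ℕ in atTop, ∀ i j : Fin N, (floorScale κ p.1 i ≤ floorScale κ p.2 j ↔
        p.1 i ≤ p.2 j) :=
      eventually_all.2 fun i => eventually_all.2 fun j =>
        eventually_floor_le_iff (h2 _).le (h4 _ _)
    filter_upwards [e1, e2, e3, e4] with κ e1 e2 e3 e4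
    simp only [Interlaces, InterlacesZero, e1, e2, e3, e4, Nat.zero_le, (h2 _).le]
  by_cases hI : Interlaces lam p.1 ∧ InterlacesZero p.1 p.2
  swap
  · rw [jointDensity, if_neg hI]
    refine tendsto_const_nhds.congr' ?_
    filter_upwards [hev] with κ hκ
    rw [stepDensity, discreteWeight, if_neg (mt hκ.1 hI), mul_zero]
  rw [jointDensity, if_pos hI]
  have hv := vdm_sq_pos h0 hlam
  have t1 := (tendsto_vdm_nodes (α + β + 1) fun i => (h2 i).le).div
    (tendsto_vdm_nodes (α + β + 1) hl0) hv.ne'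
  have t2 : Tendsto (fun κ : ℕ => branchA α β (floorScale κ p.1) (floorScale κ p.2)) atTop
      (𝓝 (∏ i, 2 * (p.2 i ^ (2 * α + 1) / p.1 i ^ (2 * α + 1)))) :=
    tendsto_finsetProd _ fun i _ => tendsto_branchB hα hβ (h1 i) (h2 i) i
  have t := (t1.mul t2).const_mul (2 ^ N * (shiftedFactorial (α + 1) N * (N.factorial : ℝ)))
  convert t.congr' ?_ using 2
  · rw [Finset.prod_mul_distrib, Finset.prod_const, Finset.card_univ, Fintype.card_fin, two_mul,
      pow_add]
    ring
  filter_upwards [hev, eventually_ne_atTop 0] with κ hκ hκ0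
  have hκ1 : ((κ : ℝ) ^ 2) ≠ 0 := by positivity
  rw [stepDensity, discreteWeight, if_pos (hκ.2 hI)]
  simp only [Pi.div_apply, vdm_const_mul]
  -- The Vandermonde product in `N + 1` variables has `N` more factors than the one in `N`
  -- variables, each of order `κ²`; this surplus is the prefactor `κ^{2N}` of `stepDensity`.
  rw [Fin.sum_univ_castSucc, Fin.val_last]
  simp only [Fin.val_castSucc]
  rw [pow_add, inv_pow, inv_pow]
  generalize vdm (nodes (α + β + 1) (floorScale κ lam)) = v
  by_cases hv0 : v = 0
  · simp [hv0]
  field_simp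

/-! ### Scheffé's argument -/

/-- Convergence of integrals from almost everywhere convergence of probability densities. -/
theorem tendsto_integral_mul_of_density {X : Type*} [MeasurableSpace X] {μ : Measure X}
    {g : ℕ → X → ℝ} {g₀ : X → ℝ} {h : ℕ → X → ℝ} {h₀ : X → ℝ} {M : ℝ}
    (hg : ∀ᶠ n in atTop, 0 ≤ g n ∧ Integrable (g n) μ ∧ ∫ x, g n x ∂μ = 1)
    (hg₀ : 0 ≤ g₀) (hi₀ : Integrable g₀ μ) (h1₀ : ∫ x, g₀ x ∂μ = 1)
    (hlim : ∀ᵐ x ∂μ, Tendsto (fun n => g n x) atTop (𝓝 (g₀ x)))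
    (hh : ∀ n, AEStronglyMeasurable (h n) μ) (hM : ∀ n x, ‖h n x‖ ≤ M)
    (hhlim : ∀ᵐ x ∂μ, Tendsto (fun n => h n x) atTop (𝓝 (h₀ x))) :
    Tendsto (fun n => ∫ x, g n x * h n x ∂μ) atTop (𝓝 (∫ x, g₀ x * h₀ x ∂μ)) := by
  have hpos : Tendsto (fun n => ∫ x, max (g₀ x - g n x) 0 ∂μ) atTop (𝓝 0) := by
    suffices hz : Tendsto (fun n => ∫ x, max (g₀ x - g n x) 0 ∂μ) atTop (𝓝 (∫ _, (0 : ℝ) ∂μ)) by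
      rwa [integral_zero] at hz
    refine tendsto_integral_filter_of_dominated_convergence g₀ ?_ ?_ hi₀ ?_
    · filter_upwards [hg] with n hn
      exact ((hi₀.sub hn.2.1).sup (integrable_zero _ _ _)).aestronglyMeasurable
    · filter_upwards [hg] with n hn
      refine ae_of_all _ fun x => ?_
      rw [Real.norm_of_nonneg (le_max_right _ _)]
      exact max_le (sub_le_self _ (hn.1 x)) (hg₀ x)
    · filter_upwards [hlim] with x hx
      simpa using (hx.const_sub (g₀ x)).max (tendsto_const_nhds (x := (0 : ℝ)))
  have habs : Tendsto (fun n => ∫ x, |g n x - g₀ x| ∂μ) atTop (𝓝 0) := by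
    have h2 := hpos.const_mul 2
    rw [mul_zero] at h2
    refine h2.congr' ?_
    filter_upwards [hg] with n hn
    -- The first term integrates to zero because both masses are one; the second is dominated by `2
    -- g₀`, so no majorant of the `g n` is required.
    have e : ∀ x, |g n x - g₀ x| = (g n x - g₀ x) + 2 * max (g₀ x - g n x) 0 := fun x => by
      rcases le_total (g n x) (g₀ x) with hle | hle
      · rw [abs_of_nonpos (by linarith), max_eq_left (by linarith)]; ring
      · rw [abs_of_nonneg (by linarith), max_eq_right (by linarith)]; ring
    simp_rw [e]
    have i1 : Integrable (fun x => g n x - g₀ x) μ := hn.2.1.sub hi₀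
    have i2 : Integrable (fun x => 2 * max (g₀ x - g n x) 0) μ :=
      ((hi₀.sub hn.2.1).sup (integrable_zero _ _ _)).const_mul 2
    rw [integral_add i1 i2, integral_sub hn.2.1 hi₀, hn.2.2, h1₀, sub_self, zero_add, integral_const_mul]
  have hfirst : Tendsto (fun n => ∫ x, (g n x - g₀ x) * h n x ∂μ) atTop (𝓝 0) := by
    have h2 := habs.const_mul M
    rw [mul_zero] at h2
    refine squeeze_zero_norm' ?_ h2
    filter_upwards [hg] with n hn
    rw [← integral_const_mul]
    refine norm_integral_le_of_norm_le ((hn.2.1.sub hi₀).abs.const_mul M) (ae_of_all _ fun x => ?_)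
    rw [norm_mul, mul_comm, Real.norm_eq_abs (g n x - g₀ x)]
    exact mul_le_mul_of_nonneg_right (hM n x) (abs_nonneg _)
  have hsecond : Tendsto (fun n => ∫ x, g₀ x * h n x ∂μ) atTop (𝓝 (∫ x, g₀ x * h₀ x ∂μ)) := by
    refine tendsto_integral_of_dominated_convergence (fun x => g₀ x * M)
      (fun n => hi₀.aestronglyMeasurable.mul (hh n)) (hi₀.mul_const M)
      (fun n => ae_of_all _ fun x => ?_) ?_
    · rw [norm_mul, Real.norm_of_nonneg (hg₀ x)]
      exact mul_le_mul_of_nonneg_left (hM n x) (hg₀ x)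
    · filter_upwards [hhlim] with x hx
      exact hx.const_mul _
  have hsum := hfirst.add hsecond
  rw [zero_add] at hsum
  refine hsum.congr' ?_
  filter_upwards [hg] with n hn
  have i1 : Integrable (fun x => (g n x - g₀ x) * h n x) μ :=
    (hn.2.1.sub hi₀).mul_bdd (hh n) (ae_of_all _ (hM n))
  have i2 : Integrable (fun x => g₀ x * h n x) μ := hi₀.mul_bdd (hh n) (ae_of_all _ (hM n))
  rw [← integral_add i1 i2]
  exact integral_congr_ae (ae_of_all _ fun x => by ring)

/-! ### The discrete law as an image of the step density -/

/-- The closed positive orthant. -/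
def orthant (N : ℕ) : Set (Fin N → ℝ) := {x | ∀ i, 0 ≤ x i}

theorem measurableSet_orthant (N : ℕ) : MeasurableSet (orthant N) :=
  measurableSet_setOfPred.2 (Measurable.forall fun i =>
    measurableSet_setOfPred.1 (measurableSet_le measurable_const (measurable_pi_apply i)))

theorem measurable_floorScale (κ n : ℕ) :
    Measurable (floorScale κ : (Fin n → ℝ) → Fin n → ℕ) :=
  measurable_pi_lambda _ fun i =>
    Nat.measurable_floor.comp (measurable_const.mul (measurable_pi_apply i))

/-- Each fibre is a half-open cube of side `1/κ`. Restricting to the orthant matters at zero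
coordinates, since the natural floor sends all negative numbers to `0`. -/
theorem map_floorScale {κ : ℕ} (hκ : κ ≠ 0) (N : ℕ) :
    (volume.restrict (orthant N)).map (floorScale κ) =
      ENNReal.ofReal (((κ : ℝ)⁻¹) ^ N) • Measure.count := by
  refine Measure.ext_of_singleton fun k => ?_
  have hκ0 : (0 : ℝ) < κ := by exact_mod_cast Nat.pos_of_ne_zero hκ
  have hcell : floorScale κ ⁻¹' {k} ∩ orthant N =
      Set.univ.pi fun i => Set.Ico ((k i : ℝ) / κ) (((k i : ℝ) + 1) / κ) := by
    ext x
    simp only [Set.mem_inter_iff, Set.mem_preimage, Set.mem_singleton_iff, funext_iff,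
      Set.mem_pi, Set.mem_univ, true_implies, Set.mem_Ico, div_le_iff₀' hκ0, lt_div_iff₀' hκ0]
    constructor
    · rintro ⟨h1, h2⟩ i
      exact (Nat.floor_eq_iff (mul_nonneg hκ0.le (h2 i))).1 (h1 i)
    · intro h
      have h2 : ∀ i, 0 ≤ x i := fun i => by
        have := (k i).cast_nonneg (α := ℝ)
        exact nonneg_of_mul_nonneg_right (this.trans (h i).1) hκ0
      exact ⟨fun i => (Nat.floor_eq_iff (mul_nonneg hκ0.le (h2 i))).2 (h i), h2⟩
  rw [Measure.map_apply (measurable_floorScale κ N) (measurableSet_singleton k),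
    Measure.restrict_apply (measurable_floorScale κ N (measurableSet_singleton k)), hcell,
    Real.volume_pi_Ico, Measure.smul_apply, Measure.count_singleton, smul_eq_mul, mul_one,
    ENNReal.ofReal_pow (by positivity)]
  have : ∀ i, ((k i : ℝ) + 1) / κ - (k i : ℝ) / κ = (κ : ℝ)⁻¹ := fun i => by
    rw [← sub_div, add_sub_cancel_left, one_div]
  simp only [this, Finset.prod_const, Finset.card_univ, Fintype.card_fin]

theorem lintegral_floorScale {κ : ℕ} (hκ : κ ≠ 0) {N : ℕ} (G : (Fin N → ℕ) → ENNReal) :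
    ∫⁻ x in orthant N, G (floorScale κ x) =
      ENNReal.ofReal (((κ : ℝ)⁻¹) ^ N) * ∑' k, G k := by
  rw [← lintegral_map (Measurable.of_discrete (f := G)) (measurable_floorScale κ N),
    map_floorScale hκ, lintegral_smul_measure, lintegral_count, smul_eq_mul]

/-- Lebesgue measure on the product of two orthants. -/
noncomputable def orthantVolume (N : ℕ) : Measure ((Fin N → ℝ) × (Fin N → ℝ)) :=
  volume.restrict (orthant N ×ˢ orthant N)

theorem lintegral_floorScale_prod {κ : ℕ} (hκ : κ ≠ 0) {N : ℕ}
    (G : (Fin N → ℕ) × (Fin N → ℕ) → ENNReal) :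
    ∫⁻ p, G (floorScale κ p.1, floorScale κ p.2) ∂orthantVolume N =
      ENNReal.ofReal (((κ : ℝ)⁻¹) ^ N) * ∑' m, (ENNReal.ofReal (((κ : ℝ)⁻¹) ^ N) *
        ∑' n, G (m, n)) := by
  have hm : Measurable fun p : (Fin N → ℝ) × (Fin N → ℝ) =>
      G (floorScale κ p.1, floorScale κ p.2) :=
    (Measurable.of_discrete (f := G)).comp
      (((measurable_floorScale κ N).comp measurable_fst).prodMk
        ((measurable_floorScale κ N).comp measurable_snd))
  rw [orthantVolume, Measure.volume_eq_prod, ← Measure.prod_restrict,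
    lintegral_prod _ hm.aemeasurable]
  have hin : ∀ m, ∫⁻ y in orthant N, G (m, floorScale κ y) =
      ENNReal.ofReal (((κ : ℝ)⁻¹) ^ N) * ∑' n, G (m, n) :=
    fun m => lintegral_floorScale hκ fun n => G (m, n)
  simp only [hin]
  exact lintegral_floorScale hκ fun m => ENNReal.ofReal (((κ : ℝ)⁻¹) ^ N) * ∑' n, G (m, n)

section law
variable {α β : ℝ} (hα : -1 < α) (hβ : -1 < β) {N : ℕ}
include hα hβ

theorem discreteWeight_nonneg {lam : Fin (N + 1) → ℕ} (hlam : Monotone lam) (mu nu : Fin N → ℕ) :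
    0 ≤ discreteWeight α β lam mu nu := by
  unfold discreteWeight
  split_ifs with h
  · have h1 := shiftedFactorial_pos hα N
    have h2 := branchA_nonneg hα hβ mu nu
    have h3 := (vdm_pos (nodes_strictMono (s := α + β + 1) (by linarith) hlam)).le
    have h4 := (vdm_pos (nodes_strictMono (s := α + β + 1) (by linarith) h.2.monotone)).le
    positivity
  · exact le_rfl

theorem tsum_discreteWeight {lam : Fin (N + 1) → ℕ} (hlam : Monotone lam) (nu : Fin N → ℕ) :
    ∑' mu, ENNReal.ofReal (discreteWeight α β lam mu nu) =
      ENNReal.ofReal (jacobiKernel α β lam nu) := by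
  classical
  have hmem : ∀ mu : Fin N → ℕ, mu ∈ (Fintype.piFinset fun i : Fin N =>
      Finset.Icc (lam i.castSucc) (lam i.succ)) ↔ Interlaces lam mu := fun mu => by
    simp [Fintype.mem_piFinset, Interlaces]
  rw [jacobiKernel_eq hα, tsum_eq_sum (s := Fintype.piFinset fun i : Fin N =>
    Finset.Icc (lam i.castSucc) (lam i.succ)), ← ENNReal.ofReal_sum_of_nonneg
      fun mu _ => discreteWeight_nonneg hα hβ hlam mu nu]
  · congr 1
    refine Finset.sum_congr rfl fun mu hmu => ?_
    rw [discreteWeight]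
    simp only [(hmem mu).1 hmu, true_and]
  · intro mu hmu
    rw [discreteWeight, if_neg fun h => hmu ((hmem mu).2 h.1), ENNReal.ofReal_zero]

theorem isProbabilityMeasure_jacobiLaw (lam : DiscreteChamber (N + 1)) :
    IsProbabilityMeasure (jacobiLaw α β lam) := by
  have h := hasSum_jacobiKernel_subtype hα hβ lam.2
  constructor
  rw [jacobiLaw, Measure.sum_apply _ MeasurableSet.univ]
  simp only [Measure.smul_apply, measure_univ, smul_eq_mul, mul_one]
  rw [← ENNReal.ofReal_tsum_of_nonneg (fun nu => jacobiKernel_nonneg hα hβ lam.2 nu.2) h.summable,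
    h.tsum_eq, ENNReal.ofReal_one]

omit hα hβ in
theorem map_val_jacobiLaw_singleton (lam : DiscreteChamber (N + 1)) (nu : Fin N → ℕ) :
    (jacobiLaw α β lam).map Subtype.val {nu} = ENNReal.ofReal (jacobiKernel α β lam.1 nu) := by
  classical
  rw [Measure.map_apply measurable_subtype_coe (measurableSet_singleton nu), jacobiLaw,
    Measure.sum_apply _ (measurable_subtype_coe (measurableSet_singleton nu))]
  by_cases hnu : Monotone nu
  · rw [tsum_eq_single ⟨nu, hnu⟩]
    · rw [Measure.smul_apply, Measure.dirac_apply_of_mem (by simp), smul_eq_mul, mul_one]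
    · intro nu' hne
      rw [Measure.smul_apply, Measure.dirac_apply, Set.indicator_of_notMem, smul_zero]
      exact fun h => hne (Subtype.ext h)
  · rw [jacobiKernel_eq_zero (Or.inr hnu), ENNReal.ofReal_zero, ENNReal.tsum_eq_zero]
    intro nu'
    rw [Measure.smul_apply, Measure.dirac_apply, Set.indicator_of_notMem, smul_zero]
    rintro rfl
    exact hnu nu'.2

omit hα hβ in
theorem measurable_stepDensity (lam : Fin (N + 1) → ℝ) (κ : ℕ) :
    Measurable (stepDensity α β lam κ) :=
  ((Measurable.of_discrete (f := fun q : (Fin N → ℕ) × (Fin N → ℕ) =>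
    discreteWeight α β (floorScale κ lam) q.1 q.2)).comp
      (((measurable_floorScale κ N).comp measurable_fst).prodMk
        ((measurable_floorScale κ N).comp measurable_snd))).const_mul _

theorem stepDensity_nonneg (lam : DiscreteChamber (N + 1)) (κ : ℕ)
    (p : (Fin N → ℝ) × (Fin N → ℝ)) : 0 ≤ stepDensity α β (fun i => (lam.1 i : ℝ)) κ p := by
  refine mul_nonneg (by positivity) ?_
  rw [floorScale_natCast]
  exact discreteWeight_nonneg hα hβ (lam.scale κ).2 _ _

/-- The volumes `κ^{-N}` of the `μ`-cell and of the `ν`-cell cancel the prefactor `κ^{2N}`, and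
summing over the `μ`-cells reproduces the kernel exactly. -/
theorem map_withDensity_stepDensity (lam : DiscreteChamber (N + 1)) {κ : ℕ} (hκ : κ ≠ 0) :
    ((orthantVolume N).withDensity fun p =>
        ENNReal.ofReal (stepDensity α β (fun i => (lam.1 i : ℝ)) κ p)).map
      (fun p => floorScale κ p.2) = (jacobiLaw α β (lam.scale κ)).map Subtype.val := by
  classical
  refine Measure.ext_of_singleton fun nu => ?_
  have hm : Measurable fun p : (Fin N → ℝ) × (Fin N → ℝ) => floorScale κ p.2 :=
    (measurable_floorScale κ N).comp measurable_snd
  have hκ0 : (0 : ℝ) < κ := by exact_mod_cast Nat.pos_of_ne_zero hκ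
  rw [map_val_jacobiLaw_singleton, Measure.map_apply hm (measurableSet_singleton nu),
    withDensity_apply _ (hm (measurableSet_singleton nu)),
    ← lintegral_indicator (hm (measurableSet_singleton nu))]
  set G : (Fin N → ℕ) × (Fin N → ℕ) → ENNReal := fun q => if q.2 = nu then ENNReal.ofReal
    (((κ : ℝ) ^ 2) ^ N * discreteWeight α β (lam.scale κ).1 q.1 q.2) else 0 with hG
  trans ∫⁻ p, G (floorScale κ p.1, floorScale κ p.2) ∂orthantVolume N
  · refine lintegral_congr fun p => ?_
    simp only [Set.indicator_apply, Set.mem_preimage, Set.mem_singleton_iff, stepDensity,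
      floorScale_natCast]
    rfl
  · rw [lintegral_floorScale_prod hκ, ← tsum_discreteWeight hα hβ (lam.scale κ).2]
    simp only [hG, tsum_ite_eq, ENNReal.ofReal_mul (show 0 ≤ ((κ : ℝ) ^ 2) ^ N by positivity),
      ENNReal.tsum_mul_left]
    rw [← mul_assoc, ← mul_assoc, ← ENNReal.ofReal_mul (by positivity),
      ← ENNReal.ofReal_mul (by positivity), show ((κ : ℝ)⁻¹ ^ N * (κ : ℝ)⁻¹ ^ N * ((κ : ℝ) ^ 2) ^ N) = 1 by
        rw [← mul_pow, ← mul_pow]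
        field_simp
        simp, ENNReal.ofReal_one, one_mul]

theorem lintegral_stepDensity (lam : DiscreteChamber (N + 1)) {κ : ℕ} (hκ : κ ≠ 0) :
    ∫⁻ p, ENNReal.ofReal (stepDensity α β (fun i => (lam.1 i : ℝ)) κ p) ∂orthantVolume N = 1 := by
  have := isProbabilityMeasure_jacobiLaw hα hβ (lam.scale κ)
  have h := congrArg (fun μ => μ Set.univ) (map_withDensity_stepDensity hα hβ lam hκ)
  have hm : Measurable fun p : (Fin N → ℝ) × (Fin N → ℝ) => floorScale κ p.2 :=
    (measurable_floorScale κ N).comp measurable_snd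
  simpa [Measure.map_apply hm MeasurableSet.univ,
    Measure.map_apply measurable_subtype_coe MeasurableSet.univ] using h

end law

/-! ### Weak convergence -/

theorem integrable_and_integral_eq_one {X : Type*} [MeasurableSpace X] {μ : Measure X} {g : X → ℝ}
    (hg : Measurable g) (h0 : 0 ≤ g) (h1 : ∫⁻ x, ENNReal.ofReal (g x) ∂μ = 1) :
    Integrable g μ ∧ ∫ x, g x ∂μ = 1 := by
  refine ⟨⟨hg.aestronglyMeasurable, ?_⟩, ?_⟩
  · rw [hasFiniteIntegral_iff_ofReal (ae_of_all _ h0), h1]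
    exact ENNReal.one_lt_top
  · rw [integral_eq_lintegral_of_nonneg_ae (ae_of_all _ h0) hg.aestronglyMeasurable, h1,
      ENNReal.toReal_one]

theorem integral_withDensity_ofReal {X : Type*} [MeasurableSpace X] {μ : Measure X} {g : X → ℝ}
    (hg : Measurable g) (h0 : 0 ≤ g) (f : X → ℝ) :
    ∫ x, f x ∂(μ.withDensity fun x => ENNReal.ofReal (g x)) = ∫ x, g x * f x ∂μ := by
  rw [integral_withDensity_eq_integral_toReal_smul hg.ennreal_ofReal
    (ae_of_all _ fun _ => ENNReal.ofReal_lt_top)]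
  simp only [ENNReal.toReal_ofReal (h0 _), smul_eq_mul]

theorem withDensity_jointDensity_eq (α : ℝ) {N : ℕ} (lam : Fin (N + 1) → ℝ) :
    (volume.withDensity fun p => ENNReal.ofReal (jointDensity α lam p)) =
      (orthantVolume N).withDensity fun p => ENNReal.ofReal (jointDensity α lam p) := by
  rw [orthantVolume, ← withDensity_indicator
    ((measurableSet_orthant N).prod (measurableSet_orthant N))]
  congr 1
  refine (Set.indicator_eq_self.2 fun p hp => ?_).symm
  by_contra hcon
  refine hp ?_
  have : ¬ (Interlaces lam p.1 ∧ InterlacesZero p.1 p.2) := fun h =>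
    hcon ⟨fun i => (h.2.1 i).trans (h.2.2.1 i), h.2.1⟩
  simp only [jointDensity, if_neg this, ENNReal.ofReal_zero]

theorem ae_generic (N : ℕ) (lam : Fin (N + 1) → ℝ) : ∀ᵐ p ∂orthantVolume N,
    (∀ i, 0 < p.1 i) ∧ (∀ i, 0 < p.2 i) ∧ (∀ i j, p.1 i ≠ lam j) ∧ (∀ i j, p.1 i ≠ p.2 j) := by
  have hne : ∀ (i : Fin N) (c : ℝ), ∀ᵐ x : Fin N → ℝ, x i ≠ c := fun i c => by
    rw [volume_pi, ae_iff]
    simpa using Measure.pi_hyperplane (fun _ : Fin N => (volume : Measure ℝ)) i c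
  have h1 : ∀ᵐ p : (Fin N → ℝ) × (Fin N → ℝ), ∀ i, p.1 i ≠ 0 :=
    Measure.quasiMeasurePreserving_fst.ae (ae_forall_ne_zero N)
  have h2 : ∀ᵐ p : (Fin N → ℝ) × (Fin N → ℝ), ∀ i, p.2 i ≠ 0 :=
    Measure.quasiMeasurePreserving_snd.ae (ae_forall_ne_zero N)
  have h3 : ∀ᵐ p : (Fin N → ℝ) × (Fin N → ℝ), ∀ i j, p.1 i ≠ lam j :=
    Measure.quasiMeasurePreserving_fst.ae
      (p := fun x : Fin N → ℝ => ∀ i j, x i ≠ lam j)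
      (ae_all_iff.2 fun i => ae_all_iff.2 fun j => hne i (lam j))
  have h4 : ∀ᵐ p : (Fin N → ℝ) × (Fin N → ℝ), ∀ i j, p.1 i ≠ p.2 j := by
    refine ae_all_iff.2 fun i => ae_all_iff.2 fun j => ?_
    rw [Measure.volume_eq_prod, Measure.ae_prod_iff_ae_ae]
    · exact ae_of_all _ fun x => (hne j (x i)).mono fun y hy => hy.symm
    · exact (measurableSet_eq_fun (by fun_prop) (by fun_prop)).compl
  rw [orthantVolume]
  filter_upwards [ae_restrict_of_ae h1, ae_restrict_of_ae h2, ae_restrict_of_ae h3,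
    ae_restrict_of_ae h4, ae_restrict_mem ((measurableSet_orthant N).prod (measurableSet_orthant N))]
    with p h1 h2 h3 h4 h5
  exact ⟨fun i => lt_of_le_of_ne (h5.1 i) (h1 i).symm, fun i => lt_of_le_of_ne (h5.2 i) (h2 i).symm,
    h3, h4⟩

/-- Written over the step density, the test function is evaluated at `⌊κν⌋ / κ`, which tends to `ν`.
Density and integrand thus both vary with `κ`, which is why `tendsto_integral_mul_of_density` allows
a sequence of bounded integrands. -/
theorem tendsto_integral_jacobiLaw {α β : ℝ} (hα : -1 < α) (hβ : -1 < β) {N : ℕ}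
    (lam : DiscreteChamber (N + 1)) (hlam : StrictMono lam.1) (f : (Fin N → ℝ) →ᵇ ℝ) :
    Tendsto (fun κ : ℕ => ∫ nu, f (fun i => (κ : ℝ)⁻¹ * (nu.1 i : ℝ)) ∂jacobiLaw α β (lam.scale κ))
      atTop (𝓝 (∫ nu, f nu ∂limitMeasure α (fun i => (lam.1 i : ℝ)))) := by
  have hl0 : (0 : ℝ) ≤ (lam.1 0 : ℝ) := Nat.cast_nonneg _
  have hl : StrictMono fun i => (lam.1 i : ℝ) := fun i j hij => Nat.cast_lt.2 (hlam hij)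
  have hJ0 : 0 ≤ jointDensity α (fun i => (lam.1 i : ℝ)) := fun p => jointDensity_nonneg hα hl0 hl p
  have hJm := measurable_jointDensity α (fun i => (lam.1 i : ℝ))
  have hJ1 : ∫⁻ p, ENNReal.ofReal (jointDensity α (fun i => (lam.1 i : ℝ)) p) ∂orthantVolume N =
      1 := by
    have h := congrArg (fun μ => μ Set.univ)
      (withDensity_jointDensity_eq α (fun i => (lam.1 i : ℝ)))
    simp only [withDensity_apply _ MeasurableSet.univ, Measure.restrict_univ] at h
    rw [← h, lintegral_jointDensity hα hl0 hl]
  obtain ⟨hJi, hJe⟩ := integrable_and_integral_eq_one hJm hJ0 hJ1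
  have hscale : ∀ κ : ℕ, Measurable fun n : Fin N → ℕ => f fun i => (κ : ℝ)⁻¹ * (n i : ℝ) :=
    fun κ => Measurable.of_discrete
  have hfl : ∀ κ : ℕ, Measurable fun p : (Fin N → ℝ) × (Fin N → ℝ) => floorScale κ p.2 :=
    fun κ => (measurable_floorScale κ N).comp measurable_snd
  have key := tendsto_integral_mul_of_density (μ := orthantVolume N) (M := ‖f‖)
    (g := stepDensity α β (fun i => (lam.1 i : ℝ)))
    (h := fun κ p => f fun i => (κ : ℝ)⁻¹ * (floorScale κ p.2 i : ℝ)) (h₀ := fun p => f p.2)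
    (by
      filter_upwards [eventually_ne_atTop 0] with κ hκ
      exact ⟨fun p => stepDensity_nonneg hα hβ lam κ p, integrable_and_integral_eq_one
        (measurable_stepDensity _ κ) (fun p => stepDensity_nonneg hα hβ lam κ p)
        (lintegral_stepDensity hα hβ lam hκ)⟩)
    hJ0 hJi hJe
    (by
      filter_upwards [ae_generic N fun i => (lam.1 i : ℝ)] with p hp
      exact tendsto_stepDensity hα hβ hl0 hl hp.1 hp.2.1 hp.2.2.1 hp.2.2.2)
    (fun κ => ((hscale κ).comp (hfl κ)).aestronglyMeasurable)
    (fun κ p => f.norm_coe_le_norm _)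
    (by
      filter_upwards [ae_generic N fun i => (lam.1 i : ℝ)] with p hp
      refine (f.continuous.tendsto _).comp (tendsto_pi_nhds.2 fun i => ?_)
      refine (tendsto_floorScale_div (hp.2.1 i).le).congr fun κ => ?_
      rw [div_eq_inv_mul, floorScale])
  rw [limitMeasure_eq_map hα hl0 hl, withDensity_jointDensity_eq,
    integral_map measurable_snd.aemeasurable f.continuous.aestronglyMeasurable,
    integral_withDensity_ofReal hJm hJ0]
  refine key.congr' ?_
  filter_upwards [eventually_ne_atTop 0] with κ hκ
  rw [← integral_withDensity_ofReal (measurable_stepDensity _ κ)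
    (fun p => stepDensity_nonneg hα hβ lam κ p),
    ← integral_map (φ := fun p : (Fin N → ℝ) × (Fin N → ℝ) => floorScale κ p.2)
      (f := fun n : Fin N → ℕ => f fun i => (κ : ℝ)⁻¹ * (n i : ℝ)) (hfl κ).aemeasurable
      (hscale κ).aestronglyMeasurable,
    map_withDensity_stepDensity hα hβ lam hκ,
    integral_map measurable_subtype_coe.aemeasurable (hscale κ).aestronglyMeasurable]

end JacobiBranching

theorem mainTheorem7 (α β : ℝ) (hα : -1 < α) (hβ : -1 < β) (N : ℕ) (hN : 1 ≤ N) :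
    -- the kernel is Markov
    (∀ lam : DiscreteChamber (N + 1),
      (∀ nu : DiscreteChamber N, 0 ≤ jacobiKernel α β lam.1 nu.1) ∧
      HasSum (fun nu : DiscreteChamber N => jacobiKernel α β lam.1 nu.1) 1) ∧
    -- weak convergence of the law of `Z_{κ λ} / κ`
    (∀ lam : DiscreteChamber (N + 1), StrictMono lam.1 →
      IsProbabilityMeasure (limitMeasure α (fun i => (lam.1 i : ℝ))) ∧
      ∀ (Ω : ℕ → Type*) [∀ κ, MeasurableSpace (Ω κ)] (P : (κ : ℕ) → Measure (Ω κ))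
        [∀ κ, IsProbabilityMeasure (P κ)] (Z : (κ : ℕ) → Ω κ → DiscreteChamber N),
        (∀ κ, HasLaw (Z κ) (jacobiLaw α β (lam.scale κ)) (P κ)) →
        ∀ f : (Fin N → ℝ) →ᵇ ℝ,
          Tendsto (fun κ : ℕ => ∫ ω, f (fun i => (κ : ℝ)⁻¹ * ((Z κ ω).1 i : ℝ)) ∂(P κ)) atTop
            (𝓝 (∫ nu, f nu ∂(limitMeasure α (fun i => (lam.1 i : ℝ)))))) ∧
    -- the substitution `x = λ²`
    (∀ lam : Fin (N + 1) → ℝ, 0 ≤ lam 0 → StrictMono lam →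
      (limitMeasure α lam).map (fun nu i => nu i ^ 2) =
        lambdaKernel α (fun i => lam i ^ 2)) := by
  refine ⟨fun lam => ⟨fun nu => jacobiKernel_nonneg hα hβ lam.2 nu.2,
    hasSum_jacobiKernel_subtype hα hβ lam.2⟩, fun lam hlam => ⟨?_, ?_⟩,
    fun lam h0 hlam => map_sq_limitMeasure h0 hlam⟩
  · exact isProbabilityMeasure_limitMeasure hα (Nat.cast_nonneg _)
      fun i j hij => Nat.cast_lt.2 (hlam hij)
  · intro Ω _ P _ Z hZ f
    refine (tendsto_integral_jacobiLaw hα hβ lam hlam f).congr fun κ => ?_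
    exact ((hZ κ).integral_comp (Measurable.of_discrete (f := fun nu : DiscreteChamber N =>
      f fun i => (κ : ℝ)⁻¹ * (nu.1 i : ℝ))).aestronglyMeasurable).symm
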